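/- Let $\Gamma=(V,E)$ be a finite simple graph with two distinct marked vertices $a,b$ such that some automorphism of $\Gamma$ exchanges $a$ and $b$, and suppose that $\Gamma$ is $2$-connected, i.e. it is connected, has at least three vertices, and no removal of a single vertex disconnects it. Let $\{\Gamma_n\}_{n\ge 0}$ be the hierarchical lattice generated by $\Gamma$: $\Gamma_0$ is a single edge with its two endpoints marked, and $\Gamma_{n+1}$ is obtained from $\Gamma$ by replacing each edge by a copy of $\Gamma_n$, using the marked vertices of $\Gamma_n$ as the endpoints of that edge and retaining $a$ and $b$ as marked vertices (so $\Gamma_1=\Gamma$). For a finite graph $G=(V_G,E_G)$ let $$Z_G(q,y)=\sum_{A\subseteq E_G} q^{k(A)}(y-1)^{|A|}\in\mathbb{C}[q,y]$$ be the partition function of the Potts model, where $k(A)$ is the number of connected components of $(V_G,A)$; for integers $q\ge 1$ it equals $\sum_{\sigma:V_G\to\{1,\dots,q\}}y^{\mathcal{E}(\sigma)}$, where $\mathcal{E}(\sigma)$ is the number of edges whose endpoints have the same spin under $\sigma$. Put $Z_n=Z_{\Gamma_n}$, and let $\mathcal{S}_n=(Z_n(q,y)=0)$ be its zero divisor (the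 sum, with multiplicities, of the closures in $\mathbb{C}\times\mathbb{P}^1$ of the irreducible components of the curve $Z_n=0$ in $\mathbb{C}^2$). Let $\mathcal{U}(q,y)$ and $\mathcal{V}(q,y)$ be the polynomials given for integers $q\ge 2$ by the sums of $y^{\mathcal{E}(\sigma)}$ over the configurations $\sigma:V\to\{1,\dots,q\}$ on $\Gamma$ with $\sigma(a)=\sigma(b)=1$, respectively with $\sigma(a)=1$ and $\sigma(b)=2$. The Migdal–Kadanoff renormalization mapping of $\Gamma$ is the rational map $$R:\mathbb{C}\times\mathbb{P}^1\dashrightarrow\mathbb{C}\times\mathbb{P}^1,\qquad R(q,y)=(q,r_q(y)),\qquad r_q(y)=\frac{\mathcal{U}(q,y)}{\mathcal{V}(q,y)}.$$ Then: 1. $R$ has generic degree $|E|$: for all but finitely many $q\in\mathbb{C}$, the rational map $r_q:\mathbb{P}^1\to\mathbb{P}^1$ has degree $|E|$. 2. $r_q$ is defined over $\mathbb{Q}$: $r_q(y)=P(q,y)/Q(q,y)$ for some $P,Q\in\mathbb{Q}[q,y]$, $Q\neq 0$, without common factors of positive degree. 3. $\mathcal{S}_0=(q(y+q-1)=0)$,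 and for every $n\ge 0$ $$\mathcal{S}_n=(R^n)^*\mathcal{S}_0$$ as divisors on $\mathbb{C}\times\mathbb{P}^1$, where $(R^n)^*$ is the pullback of divisors by the $n$-th iterate of $R$ as a rational map. -/

import Mathlib

open Polynomial

universe u

noncomputable section

namespace Potts

/-! ## Potts partition functions as polynomials in `q` and `y` -/

/-- Polynomials in two variables: `Poly2 k = k[q][y]`. -/
abbrev Poly2 (k : Type*) [CommSemiring k] := Polynomial (Polynomial k)

/-- The variable `q`. -/
def qVar : Poly2 ℂ := C X

/-- The variable `y`. -/
def yVar : Poly2 ℂ := X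

/-- The connected components of the spanning subgraph `(V, A)`, isolated vertices included. -/
abbrev Comp {V : Type u} (A : Finset (Sym2 V)) : Type u :=
  (SimpleGraph.fromEdgeSet (A : Set (Sym2 V))).ConnectedComponent

/-- The component of the vertex `v` in the spanning subgraph `(V, A)`. -/
abbrev compOf {V : Type u} (A : Finset (Sym2 V)) (v : V) : Comp A :=
  (SimpleGraph.fromEdgeSet (A : Set (Sym2 V))).connectedComponentMk v

/-- The edges of a finite graph. -/
def edges {V : Type u} [Finite V] (G : SimpleGraph V) : Finset (Sym2 V) :=
  G.edgeSet.toFinite.toFinset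

/-- The partition function `Z_G(q, y)` of the Potts model, as a polynomial, in its
Fortuin–Kasteleyn form `∑_{A ⊆ E} q ^ k(A) (y - 1) ^ |A|`, where `k(A)` is the number of components
of `(V, A)`. By `eval_partitionFunction` it is `∑_σ y ^ (number of edges with equal spins)`. -/
def partitionFunction {V : Type u} [Finite V] (G : SimpleGraph V) : Poly2 ℂ :=
  ∑ A ∈ (edges G).powerset, qVar ^ Nat.card (Comp A) * (yVar - 1) ^ A.card

/-- The number of components of `(V, A)` that contain neither `a` nor `b`. -/
def freeComps {V : Type u} (A : Finset (Sym2 V)) (a b : V) : ℕ :=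
  Nat.card {c : Comp A // ¬ (c = compOf A a ∨ c = compOf A b)}

/-- The conditional partition function `U_G(q, y)`: the sum of `y ^ (number of edges with equal
spins)` over all spin configurations with `σ a = σ b = 1`, as a polynomial in `q` and `y`
(see `eval_condSame`). -/
def condSame {V : Type u} [Finite V] (G : SimpleGraph V) (a b : V) : Poly2 ℂ :=
  ∑ A ∈ (edges G).powerset, qVar ^ freeComps A a b * (yVar - 1) ^ A.card

open Classical in
/-- The conditional partition function `V_G(q, y)`: the sum of `y ^ (number of edges with equal
spins)` over all spin configurations with `σ a = 1`, `σ b = 2`, as a polynomial in `q` and `y`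
(see `eval_condDiff`). -/
def condDiff {V : Type u} [Finite V] (G : SimpleGraph V) (a b : V) : Poly2 ℂ :=
  ∑ A ∈ (edges G).powerset with compOf A a ≠ compOf A b,
    qVar ^ freeComps A a b * (yVar - 1) ^ A.card

open Classical in
/-- The number of edges whose two endpoints carry the same spin. -/
def monoEdges {V : Type u} [Finite V] (G : SimpleGraph V) {N : ℕ} (σ : V → Fin N) : ℕ :=
  ((edges G).filter fun e => (e.map σ).IsDiag).card

/-- A configuration is constant along the edges in `A` iff it is constant on the components. -/
theorem constOn_iff {V : Type u} {N : ℕ} {G : SimpleGraph V} [Finite V] {A : Finset (Sym2 V)}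
    (hA : A ⊆ edges G) (σ : V → Fin N) :
    (∀ e ∈ A, (e.map σ).IsDiag) ↔ ∀ v w, compOf A v = compOf A w → σ v = σ w := by
  constructor
  · intro h v w hvw
    obtain ⟨p⟩ := SimpleGraph.ConnectedComponent.exact hvw
    induction p with
    | nil => rfl
    | cons hadj p ih =>
      rw [← ih (SimpleGraph.ConnectedComponent.sound ⟨p⟩)]
      have := h _ (by simpa using ((SimpleGraph.fromEdgeSet_adj _).1 hadj).1)
      simpa using this
  · intro h e he
    induction e with
    | h v w =>
      have hG : G.Adj v w := by simpa [edges] using hA he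
      have : (SimpleGraph.fromEdgeSet (A : Set (Sym2 V))).Adj v w :=
        (SimpleGraph.fromEdgeSet_adj _).2 ⟨by simpa using he, hG.ne⟩
      simpa using h v w (SimpleGraph.ConnectedComponent.sound this.reachable)

/-- Expanding `∏ (1 + (y - 1) δ)`. -/
theorem pow_monoEdges {V : Type u} [Finite V] (G : SimpleGraph V) {N : ℕ} (σ : V → Fin N) (y : ℂ)
    [DecidablePred fun A : Finset (Sym2 V) => ∀ e ∈ A, (e.map σ).IsDiag] :
    y ^ monoEdges G σ = ∑ A ∈ (edges G).powerset,
      if ∀ e ∈ A, (e.map σ).IsDiag then (y - 1) ^ A.card else 0 := by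
  classical
  have h1 : y ^ monoEdges G σ =
      ∏ e ∈ edges G, (1 + if (e.map σ).IsDiag then y - 1 else 0) := by
    rw [monoEdges, ← Finset.prod_const, Finset.prod_filter]
    refine Finset.prod_congr rfl fun e _ => ?_
    split_ifs <;> ring
  rw [h1, Finset.prod_one_add]
  refine Finset.sum_congr rfl fun A _ => ?_
  rw [Finset.prod_ite_zero]
  simp

/-- Counting the configurations that are constant along `A` and prescribed on some components. -/
theorem card_constOn {V : Type u} [Finite V] {G : SimpleGraph V} {N : ℕ} {A : Finset (Sym2 V)}
    (hA : A ⊆ edges G) (p : Comp A → Prop) (g : {c : Comp A // p c} → Fin N) :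
    Nat.card {σ : V → Fin N // (∀ e ∈ A, (e.map σ).IsDiag) ∧
      ∀ v (h : p (compOf A v)), σ v = g ⟨compOf A v, h⟩} =
    N ^ Nat.card {c : Comp A // ¬ p c} := by
  classical
  have e : {σ : V → Fin N // (∀ e ∈ A, (e.map σ).IsDiag) ∧
      ∀ v (h : p (compOf A v)), σ v = g ⟨compOf A v, h⟩} ≃
      {x : Comp A → Fin N // x ∘ Subtype.val = g} :=
    { toFun := fun σ => ⟨Quot.lift σ.1 fun v w h =>
          (constOn_iff hA σ.1).1 σ.2.1 v w (SimpleGraph.ConnectedComponent.sound h), by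
          funext c
          obtain ⟨c, hc⟩ := c
          induction c using SimpleGraph.ConnectedComponent.ind with
          | h v => exact σ.2.2 v hc⟩
      invFun := fun x => ⟨fun v => x.1 (compOf A v),
        (constOn_iff hA _).2 fun v w h => by rw [h],
        fun v h => congrFun x.2 ⟨compOf A v, h⟩⟩
      left_inv := fun σ => by ext v; rfl
      right_inv := fun x => by
        ext c
        induction c using SimpleGraph.ConnectedComponent.ind with
        | h v => rfl }
  rw [Nat.card_congr (e.trans (Equiv.subtypePreimage p g)), Nat.card_fun, Nat.card_fin]

/-- Exchanging the sums over configurations and over sets of edges. -/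
theorem sum_pow_monoEdges {V : Type u} [Finite V] (G : SimpleGraph V) {N : ℕ} (y : ℂ)
    (S : Finset (V → Fin N)) :
    ∑ σ ∈ S, y ^ monoEdges G σ = ∑ A ∈ (edges G).powerset,
      (Nat.card {σ : V → Fin N // σ ∈ S ∧ ∀ e ∈ A, (e.map σ).IsDiag} : ℂ) * (y - 1) ^ A.card := by
  classical
  simp_rw [pow_monoEdges]
  rw [Finset.sum_comm]
  refine Finset.sum_congr rfl fun A _ => ?_
  rw [← Finset.sum_filter, Finset.sum_const, nsmul_eq_mul]
  congr 2
  exact (Nat.subtype_card _ (by simp)).symm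

open Classical in
/-- At an integer `q = N`, the polynomial `partitionFunction` is the Potts partition function. -/
theorem eval_partitionFunction {V : Type u} [Fintype V] (G : SimpleGraph V) (N : ℕ) (y : ℂ) :
    (partitionFunction G).evalEval (N : ℂ) y = ∑ σ : V → Fin N, y ^ monoEdges G σ := by
  rw [sum_pow_monoEdges, partitionFunction, evalEval_finsetSum]
  refine Finset.sum_congr rfl fun A hA => ?_
  have h := card_constOn (N := N) (Finset.mem_powerset.1 hA) (fun _ => False) (fun c => c.2.elim)
  have e : Nat.card {c : Comp A // ¬ False} = Nat.card (Comp A) :=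
    Nat.card_congr (Equiv.subtypeUnivEquiv fun _ => not_false)
  rw [e] at h
  have h' : Nat.card {σ : V → Fin N // σ ∈ Finset.univ ∧ ∀ e ∈ A, (e.map σ).IsDiag} =
      N ^ Nat.card (Comp A) := by
    rw [← h]
    exact Nat.card_congr (Equiv.subtypeEquivRight fun σ => by simp)
  rw [h']
  simp [qVar, yVar, evalEval]

open Classical in
/-- At an integer `q = N`, `condSame` sums over the configurations with `σ a = σ b = c`. -/
theorem eval_condSame {V : Type u} [Fintype V] (G : SimpleGraph V) (a b : V) (N : ℕ) (c : Fin N)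
    (y : ℂ) : (condSame G a b).evalEval (N : ℂ) y =
      ∑ σ : V → Fin N with σ a = c ∧ σ b = c, y ^ monoEdges G σ := by
  rw [sum_pow_monoEdges, condSame, evalEval_finsetSum]
  refine Finset.sum_congr rfl fun A hA => ?_
  have hA' := Finset.mem_powerset.1 hA
  have h := card_constOn (N := N) hA' (fun x => x = compOf A a ∨ x = compOf A b) (fun _ => c)
  have h' : Nat.card {σ : V → Fin N // σ ∈ (Finset.univ.filter fun σ : V → Fin N =>
      σ a = c ∧ σ b = c) ∧ ∀ e ∈ A, (e.map σ).IsDiag} = N ^ freeComps A a b := by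
    rw [freeComps, ← h]
    refine Nat.card_congr (Equiv.subtypeEquivRight fun σ => ?_)
    simp only [Finset.mem_filter, Finset.mem_univ, true_and]
    constructor
    · rintro ⟨⟨ha, hb⟩, hd⟩
      refine ⟨hd, fun v hv => ?_⟩
      rcases hv with hv | hv
      · rw [(constOn_iff hA' σ).1 hd _ _ hv, ha]
      · rw [(constOn_iff hA' σ).1 hd _ _ hv, hb]
    · rintro ⟨hd, hv⟩
      exact ⟨⟨hv a (Or.inl rfl), hv b (Or.inr rfl)⟩, hd⟩
  rw [h']
  simp [qVar, yVar, evalEval]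

open Classical in
/-- At an integer `q = N`, `condDiff` sums over the configurations with `σ a = c`, `σ b = d`, for
any two different spins `c` and `d`. -/
theorem eval_condDiff {V : Type u} [Fintype V] (G : SimpleGraph V) (a b : V) (N : ℕ) (c d : Fin N)
    (hcd : c ≠ d) (y : ℂ) : (condDiff G a b).evalEval (N : ℂ) y =
      ∑ σ : V → Fin N with σ a = c ∧ σ b = d, y ^ monoEdges G σ := by
  rw [sum_pow_monoEdges, condDiff, evalEval_finsetSum, Finset.sum_filter]
  refine Finset.sum_congr rfl fun A hA => ?_
  have hA' := Finset.mem_powerset.1 hA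
  by_cases hab : compOf A a = compOf A b
  · have h' : Nat.card {σ : V → Fin N // σ ∈ (Finset.univ.filter fun σ : V → Fin N =>
        σ a = c ∧ σ b = d) ∧ ∀ e ∈ A, (e.map σ).IsDiag} = 0 := by
      rw [Nat.card_eq_zero]
      refine Or.inl ⟨fun σ => hcd ?_⟩
      obtain ⟨hs, hd⟩ := σ.2
      obtain ⟨ha, hb⟩ := (Finset.mem_filter.1 hs).2
      exact ha.symm.trans (((constOn_iff hA' σ.1).1 hd _ _ hab).trans hb)
    rw [h']
    simp [hab]
  · have h := card_constOn (N := N) hA' (fun x => x = compOf A a ∨ x = compOf A b)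
      (fun x => if x.1 = compOf A a then c else d)
    have h' : Nat.card {σ : V → Fin N // σ ∈ (Finset.univ.filter fun σ : V → Fin N =>
        σ a = c ∧ σ b = d) ∧ ∀ e ∈ A, (e.map σ).IsDiag} = N ^ freeComps A a b := by
      rw [freeComps, ← h]
      refine Nat.card_congr (Equiv.subtypeEquivRight fun σ => ?_)
      simp only [Finset.mem_filter, Finset.mem_univ, true_and]
      constructor
      · rintro ⟨⟨ha, hb⟩, hd⟩
        refine ⟨hd, fun v hv => ?_⟩
        rcases hv with hv | hv
        · rw [(constOn_iff hA' σ).1 hd _ _ hv, ha, if_pos hv]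
        · rw [(constOn_iff hA' σ).1 hd _ _ hv, hb, if_neg]
          rw [hv]
          exact fun h => hab h.symm
      · rintro ⟨hd, hv⟩
        refine ⟨⟨?_, ?_⟩, hd⟩
        · rw [hv a (Or.inl rfl), if_pos rfl]
        · rw [hv b (Or.inr rfl), if_neg fun h => hab h.symm]
    rw [h', if_pos hab]
    simp [qVar, yVar, evalEval]

/-! ## Hierarchical lattices -/

/-- A finite simple graph with two different marked vertices `a` and `b`. -/
structure TwoPointGraph where
  V : Type u
  finite : Finite V
  graph : SimpleGraph V
  a : V
  b : V
  a_ne_b : a ≠ b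

instance (Γ : TwoPointGraph.{u}) : Finite Γ.V := Γ.finite

/-- The graph is symmetric over its marked vertices: some automorphism exchanges them. -/
def TwoPointGraph.IsSymmetric (Γ : TwoPointGraph.{u}) : Prop :=
  ∃ φ : Γ.graph ≃g Γ.graph, φ Γ.a = Γ.b ∧ φ Γ.b = Γ.a

/-- A graph is `2`-connected if it is connected, has at least three vertices, and stays connected
when any one vertex is removed. -/
def TwoConnected {V : Type u} (G : SimpleGraph V) : Prop :=
  3 ≤ Nat.card V ∧ G.Connected ∧ ∀ v : V, (G.induce {v}ᶜ).Connected

/-- A choice, for every edge, of which endpoint comes first. -/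
structure EdgeOrder {V : Type u} (G : SimpleGraph V) where
  fst : G.edgeSet → V
  snd : G.edgeSet → V
  mk_eq : ∀ e, s(fst e, snd e) = e.1

/-- The vertices after every edge of `G` has been replaced by a copy of `H`: those of `G`, and for
every edge of `G` the unmarked vertices of `H`. -/
abbrev SubstVertex {V : Type u} (G : SimpleGraph V) (H : TwoPointGraph.{u}) : Type u :=
  V ⊕ G.edgeSet × {w : H.V // w ≠ H.a ∧ w ≠ H.b}

open Classical in
/-- The copy of `H` that replaces the edge `e`: the marked vertices of `H` are the endpoints
of `e`. -/
def place {V : Type u} {G : SimpleGraph V} (o : EdgeOrder G) (H : TwoPointGraph.{u})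
    (e : G.edgeSet) (w : H.V) : SubstVertex G H :=
  if ha : w = H.a then Sum.inl (o.fst e)
  else if hb : w = H.b then Sum.inl (o.snd e)
  else Sum.inr (e, ⟨w, ha, hb⟩)

theorem place_injective {V : Type u} {G : SimpleGraph V} (o : EdgeOrder G) (H : TwoPointGraph.{u})
    (e : G.edgeSet) : Function.Injective (place o H e) := by
  have hne : o.fst e ≠ o.snd e := by
    have h : G.Adj (o.fst e) (o.snd e) := by
      rw [← SimpleGraph.mem_edgeSet, o.mk_eq]
      exact e.2
    exact h.ne
  intro w w' h
  unfold place at h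
  split_ifs at h <;> simp_all

/-- The graph obtained from `Γ` by replacing each edge by a copy of `H`, the marked vertices of `H`
being used as the endpoints of that edge. The marked vertices of `Γ` remain marked. -/
def TwoPointGraph.subst (Γ : TwoPointGraph.{u}) (o : EdgeOrder Γ.graph) (H : TwoPointGraph.{u}) :
    TwoPointGraph.{u} where
  V := SubstVertex Γ.graph H
  finite := inferInstance
  graph :=
    { Adj := fun x x' => ∃ e w w', H.graph.Adj w w' ∧ place o H e w = x ∧ place o H e w' = x'
      symm := ⟨fun _ _ ⟨e, w, w', h, hx, hx'⟩ => ⟨e, w', w, h.symm, hx', hx⟩⟩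
      loopless := ⟨fun _ ⟨e, _, _, h, hx, hx'⟩ =>
        h.ne (place_injective o H e (hx.trans hx'.symm))⟩ }
  a := Sum.inl Γ.a
  b := Sum.inl Γ.b
  a_ne_b := fun h => Γ.a_ne_b (Sum.inl_injective h)

/-- A single edge with its two endpoints, both marked. -/
def singleEdge : TwoPointGraph.{u} where
  V := ULift (Fin 2)
  finite := inferInstance
  graph := ⊤
  a := ⟨0⟩
  b := ⟨1⟩
  a_ne_b := by simp

/-- The hierarchical lattice generated by `Γ`: `Γ₀` is a single edge and `Γₙ₊₁` is `Γ` with each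
edge replaced by a copy of `Γₙ`. In particular `Γ₁` is `Γ` itself, up to renaming its vertices. If
`Γ` is symmetric over its marked vertices, the ordering `o` of the endpoints of the edges does not
matter up to isomorphism. -/
def lattice (Γ : TwoPointGraph.{u}) (o : EdgeOrder Γ.graph) : ℕ → TwoPointGraph.{u}
  | 0 => singleEdge
  | n + 1 => Γ.subst o (lattice Γ o n)

/-! ## Divisors on `ℂ × ℙ¹` and rational maps `(q, y) ↦ (q, r(q, y))` -/

/-- The field `ℂ(q, y)` of rational functions on `ℂ × ℙ¹`. -/
abbrev FunField := FractionRing (Poly2 ℂ)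

/-- Irreducible plane curves: irreducible polynomials in `ℂ[q, y]` up to nonzero constants. -/
abbrev PlaneCurve := {p : Associates (Poly2 ℂ) // Irreducible p}

/-- The irreducible curves in `ℂ × ℙ¹`: `some p` is the closure of the plane curve `p = 0`, and
`none` is the line `y = ∞`. -/
abbrev PrimeDivisor := Option PlaneCurve

/-- Divisors on `ℂ × ℙ¹`. -/
abbrev Divisor := PrimeDivisor →₀ ℤ

/-- The zero divisor `(P = 0)` of a nonzero polynomial `P(q, y)`: the sum of the curves defined by
its irreducible factors, with multiplicities. -/
def zeroDivisor (P : Poly2 ℂ) : Divisor :=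
  ((Associates.factors' P).map fun p => Finsupp.single (some p) (1 : ℤ)).sum

/-- The divisor, zeros minus poles, on `ℂ × ℙ¹` of a nonzero rational function `f`. A polynomial
has along the line `y = ∞` a pole whose order is its degree in `y`. -/
def principal (f : FunField) : Divisor :=
  let P : Poly2 ℂ := IsFractionRing.num (Poly2 ℂ) f
  let Q : Poly2 ℂ := IsFractionRing.den (Poly2 ℂ) f
  zeroDivisor P - zeroDivisor Q + Finsupp.single none ((Q.natDegree : ℤ) - P.natDegree)

/-- An equation of a prime divisor in the chart `ℂ × ℂ` with the coordinates `(q, y)`. -/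
def eqFinite : PrimeDivisor → Poly2 ℂ
  | some p => Quot.out p.1
  | none => 1

/-- An equation of a prime divisor in the chart at infinity, with the coordinates `(q, w)`,
`w = 1 / y`: for the closure of `p(q, y) = 0` it is `w ^ deg p * p(q, 1 / w)`, the degree being that
in `y`, and for the line `y = ∞` it is `w`. -/
def eqInfinite : PrimeDivisor → Poly2 ℂ
  | some p => (Quot.out p.1).reverse
  | none => X

/-- `P(q, s)` for a polynomial `P(q, y)` and a rational function `s`. -/
def substY (s : FunField) (P : Poly2 ℂ) : FunField :=
  P.eval₂ (algebraMap (Polynomial ℂ) FunField) s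

open Classical in
/-- The pullback of the prime divisor `D` by the rational map `(q, y) ↦ (q, r(q, y))`, where `r` is
not constant in `y`. The generic point of a curve `E` is mapped into the finite chart if `r` has no
pole along `E`, and into the chart at infinity if it has one. The multiplicity of `E` in the
pullback is the order along `E` of the equation of `D` in that chart, composed with the map. -/
def pullbackPrime (r : FunField) (D : PrimeDivisor) : Divisor :=
  (principal (substY r (eqFinite D))).filter (fun E => 0 ≤ principal r E) +
    (principal (substY r⁻¹ (eqInfinite D))).filter (fun E => principal r E < 0)

/-- The pullback of a divisor by the rational map `(q, y) ↦ (q, r(q, y))`. -/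
def pullback (r : FunField) (D : Divisor) : Divisor :=
  D.sum fun F m => m • pullbackPrime r F

/-- The second component `r(q, s(q, y))` of the composition of `(q, y) ↦ (q, r(q, y))` after
`(q, y) ↦ (q, s(q, y))`, where `s` is not constant in `y`. -/
def compY (r s : FunField) : FunField :=
  substY s (IsFractionRing.num (Poly2 ℂ) r) /
    substY s (IsFractionRing.den (Poly2 ℂ) r : Poly2 ℂ)

/-- The second component of the `n`-th iterate of `(q, y) ↦ (q, r(q, y))`. -/
def iterY (r : FunField) : ℕ → FunField
  | 0 => algebraMap (Poly2 ℂ) FunField yVar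
  | n + 1 => compY r (iterY r n)

/-- The rational function `y ↦ r(q₀, y)` in one variable. (If the denominator of `r` vanishes
identically at `q₀`, this is the constant `∞`; it is then represented by the constant `0`, which
has the same degree.) -/
def specialize (r : FunField) (q₀ : ℂ) : RatFunc ℂ :=
  algebraMap (Polynomial ℂ) (RatFunc ℂ)
      ((IsFractionRing.num (Poly2 ℂ) r).map (evalRingHom q₀)) /
    algebraMap (Polynomial ℂ) (RatFunc ℂ)
      ((IsFractionRing.den (Poly2 ℂ) r : Poly2 ℂ).map (evalRingHom q₀))

/-- The degree of a rational map `ℙ¹ → ℙ¹`. -/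
def mapDegree (f : RatFunc ℂ) : ℕ := max f.num.natDegree f.denom.natDegree

/-- The rational map `y ↦ r(q, y)` has degree `d` for all but finitely many `q`. -/
def HasGenericDegree (r : FunField) (d : ℕ) : Prop :=
  {q₀ : ℂ | mapDegree (specialize r q₀) ≠ d}.Finite

/-- `r` is defined over `ℚ`: it is a quotient of two polynomials in `q` and `y` with rational
coefficients and without common factors of positive degree. -/
def DefinedOverRat (r : FunField) : Prop :=
  ∃ P Q : Poly2 ℚ, Q ≠ 0 ∧ IsRelPrime P Q ∧
    r = algebraMap (Poly2 ℂ) FunField (P.map (mapRingHom (algebraMap ℚ ℂ))) /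
      algebraMap (Poly2 ℂ) FunField (Q.map (mapRingHom (algebraMap ℚ ℂ)))

/-! ## The Migdal–Kadanoff renormalization mapping -/

/-- The second component `r_q(y)` of the Migdal–Kadanoff renormalization mapping
`R(q, y) = (q, r_q(y))` of the generating graph `Γ`: the ratio of the two conditional partition
functions of `Γ`. (Write `Uₙ`, `Vₙ` for the conditional partition functions of `Γₙ`. Fixing the spins
of `Γₙ₊₁` at the vertices of `Γ`, each copy of `Γₙ` contributes `Uₙ` or `Vₙ`, so a configuration on
`Γ` with `m` monochromatic edges contributes `Uₙ ^ m * Vₙ ^ (|E| - m)`; dividing by `Vₙ ^ |E|`, the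
ratio `yₙ = Uₙ / Vₙ`, with `y₀ = y`, satisfies `yₙ₊₁ = r_q(yₙ)`.) -/
def migdalKadanoff (Γ : TwoPointGraph.{u}) : FunField :=
  algebraMap (Poly2 ℂ) FunField (condSame Γ.graph Γ.a Γ.b) /
    algebraMap (Poly2 ℂ) FunField (condDiff Γ.graph Γ.a Γ.b)

/-- The zero divisor `S_n` of the Potts partition function of the `n`-th graph of the lattice. -/
def pottsDivisor (Γ : TwoPointGraph.{u}) (o : EdgeOrder Γ.graph) (n : ℕ) : Divisor :=
  zeroDivisor (partitionFunction (lattice Γ o n).graph)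

end Potts

end

noncomputable section

namespace Potts

/-! ## Nonvanishing of an alternating sum over connecting edge sets -/

section Alternating

open Classical

/-! Write `U`, `V` for the conditional partition functions of Γ, `Uₙ`, `Vₙ` for those of Γₙ, and `d
= |E|`. The only edge set contributing degree `d` in `y` is `E` itself. It connects `a` and `b`, so
`U` is monic of degree `d` in `y` and `V` has smaller degree. Everything else depends on the
coprimality of `U` and `V`.

Coprimality is tested at `q = 1`. There `U = y ^ d` by the binomial theorem, so the resultant of `U`
and `V` in `y` specializes, up to sign, to a power of `V(1, 0)`, the alternating sum of `(-1) ^ |A|`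
over the edge sets that do not connect `a` and `b`. It is nonzero because Γ is 2-connected. This is
the combinatorial core (`rootedSum_sign`): a deletion recursion shows that the alternating sum over
connecting sets has a definite sign, and that it is strict when no vertex separates the graph from
its marked vertices. So the resultant is a nonzero polynomial in `q`. Away from its roots `r_q` has
degree `d`, and a Bézout identity for `U`, `V` with a right-hand side in `ℂ[q]` shows that they have
no common factor in `ℂ[q, y]`. The formulas for `U`, `V` have rational coefficients, whence the
field of definition.

For the lattice, fixing the spins on Γ makes the copies of Γₙ independent, so `Uₙ₊₁` and `Vₙ₊₁` are
the degree `d` homogenizations of `U` and `V` at `(Uₙ, Vₙ)` (`condSame_subst`, `condDiff_subst`).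
Homogenizing the Bézout identity preserves coprimality, so the `n`-th iterate of the map is `Uₙ /
Vₙ` in lowest terms (`lattice_invariant`). Since `Zₙ = q (Uₙ + (q - 1) Vₙ)`, the pullback of `q (y +
q - 1) = 0` by this fraction is the divisor of `Zₙ`: no cancellation occurs, and nothing is gained
or lost along poles or at `y = ∞` (`pullbackPrime_line`). -/

theorem mem_of_reachable {V : Type u} {H : SimpleGraph V} {S : Set V}
    (hS : ∀ u v, H.Adj u v → u ∈ S → v ∈ S) {u v : V} (h : H.Reachable u v) (hu : u ∈ S) :
    v ∈ S := by
  obtain ⟨p⟩ := h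
  induction p with
  | nil => exact hu
  | cons hadj p ih => exact ih (hS _ _ hadj hu)

/-- The spanning graph whose edges are those in `A`. -/
abbrev spanGraph {V : Type u} (A : Finset (Sym2 V)) : SimpleGraph V :=
  SimpleGraph.fromEdgeSet (A : Set (Sym2 V))

/-- The edges of `G` with both endpoints in `W`, as a graph on all vertices. -/
def restrictTo {V : Type u} (G : SimpleGraph V) (W : Finset V) : SimpleGraph V where
  Adj u v := G.Adj u v ∧ u ∈ W ∧ v ∈ W
  symm := ⟨fun _ _ h => ⟨h.1.symm, h.2.2, h.2.1⟩⟩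
  loopless := ⟨fun _ h => h.1.ne rfl⟩

theorem mem_of_reachable_restrictTo {V : Type u} {G : SimpleGraph V} {W : Finset V} {u v : V}
    (h : (restrictTo G W).Reachable u v) (hu : u ∈ W) : v ∈ W :=
  mem_of_reachable (H := restrictTo G W) (S := {v | v ∈ W}) (fun _ _ hadj _ => hadj.2.2) h hu

variable {V : Type u} (G : SimpleGraph V)

/-- The neighbours of `x` in `W`. -/
def neighborsIn (W : Finset V) (x : V) : Finset V := W.filter fun y => G.Adj x y

variable {G}

/-- After removing any vertex `v`, every vertex is still connected to `b` or to a vertex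
of `N`. -/
def IsGuarded (G : SimpleGraph V) (b : V) (W N : Finset V) : Prop :=
  ∀ v ∈ W, ∀ w ∈ W, w ≠ v →
    ∃ z ∈ insert b N, z ≠ v ∧ z ∈ W ∧ (restrictTo G (W.erase v)).Reachable w z

/-- A path from `w` to its guard that avoids `x` survives the deletion of `x`. A path that meets `x`
passes through a neighbour of `x` just before, and that neighbour is one of the new guards. -/
theorem IsGuarded.erase {b x : V} {W N : Finset V} (h : IsGuarded G b W (insert x N)) :
    IsGuarded G b (W.erase x) (N ∪ neighborsIn G W x) := by
  intro v hv w hw hwv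
  by_contra! hcon
  have hw' := Finset.mem_erase.1 hw
  have hv' := Finset.mem_erase.1 hv
  obtain ⟨z, hz, hzv, hzW, hr⟩ := h v hv'.2 w hw'.2 hwv
  set S : Set V := {u | (restrictTo G ((W.erase x).erase v)).Reachable w u}
  have hmem : ∀ u ∈ S, u ∈ (W.erase x).erase v := fun u hu =>
    mem_of_reachable_restrictTo hu (Finset.mem_erase.2 ⟨hwv, hw⟩)
  have hzS : z ∈ S := by
    refine mem_of_reachable (fun u u' hadj hu => ?_) hr (SimpleGraph.Reachable.refl w)
    have huW := hmem u hu
    simp only [Finset.mem_erase] at huW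
    have hu' := Finset.mem_erase.1 hadj.2.2
    by_cases hux : u' = x
    · subst hux
      refine absurd hu (hcon u ?_ huW.1 (by simp [huW]))
      refine Finset.mem_insert_of_mem (Finset.mem_union_right _ ?_)
      exact Finset.mem_filter.2 ⟨huW.2.2, hadj.1.symm⟩
    · refine SimpleGraph.Reachable.trans hu (SimpleGraph.Adj.reachable ⟨hadj.1, hmem u hu, ?_⟩)
      simp [hu', hux]
  have hzx := hmem z hzS
  simp only [Finset.mem_erase] at hzx
  refine hcon z ?_ hzv (by simp [hzx]) hzS
  simp only [Finset.mem_insert, Finset.mem_union] at hz ⊢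
  rcases hz with h | h | h
  · exact Or.inl h
  · exact absurd h hzx.2.1
  · exact Or.inr (Or.inl h)

/-- If `x` is a cut vertex of `W`, it is superfluous as a guard: from `x` one can continue into a
component of `W \ x` that misses the removed vertex `v`, and that component contains another guard,
because `x` itself was an admissible removed vertex. -/
theorem IsGuarded.of_insert {b x w₀ : V} {W N : Finset V} (h : IsGuarded G b W (insert x N))
    (hb : b ∈ W) (hxb : b ≠ x) (hx : x ∈ W) (hconn : ∀ w ∈ W, (restrictTo G W).Reachable b w)
    (hw₀ : w₀ ∈ W.erase x) (hnot : ¬ (restrictTo G (W.erase x)).Reachable b w₀) :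
    IsGuarded G b W N := by
  intro v hv w hw hwv
  obtain ⟨z, hz, hzv, hzW, hr⟩ := h v hv w hw hwv
  rw [Finset.insert_comm, Finset.mem_insert] at hz
  rcases hz with rfl | hz
  swap
  · exact ⟨z, hz, hzv, hzW, hr⟩
  -- The vertex `x` is now called `z`. Since `W \ z` is disconnected, some component, that of `r`,
  -- does not contain `v`. It therefore remains connected in `W \ v`.
  obtain ⟨r, hrW, hrv⟩ : ∃ r ∈ W.erase z, ¬ (restrictTo G (W.erase z)).Reachable r v := by
    by_cases hbv : (restrictTo G (W.erase z)).Reachable b v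
    · exact ⟨w₀, hw₀, fun h => hnot (hbv.trans h.symm)⟩
    · exact ⟨b, Finset.mem_erase.2 ⟨hxb, hb⟩, hbv⟩
  have hsub : ∀ u, (restrictTo G (W.erase z)).Reachable r u →
      (restrictTo G (W.erase v)).Reachable r u := by
    intro u hu
    have := mem_of_reachable (S := {u | (restrictTo G (W.erase z)).Reachable r u ∧
      (restrictTo G (W.erase v)).Reachable r u}) (fun u u' hadj hu => ?_) hu
      ⟨SimpleGraph.Reachable.refl r, SimpleGraph.Reachable.refl r⟩
    · exact this.2
    · have hu' := hu.1.trans hadj.reachable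
      refine ⟨hu', hu.2.trans (SimpleGraph.Adj.reachable ⟨hadj.1, ?_, ?_⟩)⟩
      · refine Finset.mem_erase.2 ⟨?_, (Finset.mem_erase.1 hadj.2.1).2⟩
        rintro rfl
        exact hrv hu.1
      · refine Finset.mem_erase.2 ⟨?_, (Finset.mem_erase.1 hadj.2.2).2⟩
        rintro rfl
        exact hrv hu'
  have hrW' := Finset.mem_erase.1 hrW
  obtain ⟨t, ht, htz, htW, htr⟩ := h z hx r hrW'.2 hrW'.1
  rw [Finset.insert_comm, Finset.mem_insert] at ht
  replace ht := ht.resolve_left htz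
  -- As `W` is connected, the component of `r` in `W \ z` is adjacent to `z`. The required path goes
  -- from `w` through `z`, `y` and `r` to `t`.
  obtain ⟨y, hy, hyz⟩ : ∃ y, (restrictTo G (W.erase z)).Reachable r y ∧ G.Adj y z := by
    by_contra! hcon
    have := mem_of_reachable (S := {u | (restrictTo G (W.erase z)).Reachable r u})
      (fun u u' hadj hu => ?_) ((hconn r hrW'.2).symm.trans (hconn z hx))
      (SimpleGraph.Reachable.refl r)
    · exact (Finset.mem_erase.1 (mem_of_reachable_restrictTo this hrW)).1 rfl
    · refine SimpleGraph.Reachable.trans hu (SimpleGraph.Adj.reachable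
        ⟨hadj.1, mem_of_reachable_restrictTo hu hrW, Finset.mem_erase.2 ⟨?_, hadj.2.2⟩⟩)
      rintro rfl
      exact hcon u hu hadj.1
  refine ⟨t, ht, ?_, htW, hr.trans (SimpleGraph.Reachable.trans (SimpleGraph.Adj.reachable
    ⟨hyz.symm, Finset.mem_erase.2 ⟨hzv, hx⟩, Finset.mem_erase.2 ⟨?_, ?_⟩⟩)
    ((hsub y hy).symm.trans (hsub t htr)))⟩
  · rintro rfl
    exact hrv htr
  · rintro rfl
    exact hrv hy
  · exact (Finset.mem_erase.1 (mem_of_reachable_restrictTo hy hrW)).2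

variable [Finite V] (G)

/-- The edges of `G` with both endpoints in `W`. -/
def edgesIn (W : Finset V) : Finset (Sym2 V) :=
  (edges G).filter fun e => ∀ v ∈ e, v ∈ W

/-- The sum of `(-1) ^ |A|` over the sets `A` of edges in `W` that connect `b` to all of `N`. -/
def rootedSum (b : V) (W N : Finset V) : ℤ :=
  ∑ A ∈ (edgesIn G W).powerset,
    if ∀ n ∈ N, (spanGraph A).Reachable b n then (-1) ^ A.card else 0

variable {G}

theorem mk_mem_edges {u v : V} : s(u, v) ∈ edges G ↔ G.Adj u v := by
  simp [edges]

theorem mk_mem_edgesIn {W : Finset V} {u v : V} :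
    s(u, v) ∈ edgesIn G W ↔ (restrictTo G W).Adj u v := by
  simp [edgesIn, mk_mem_edges, restrictTo]

theorem spanGraph_le_restrictTo {W : Finset V} {A : Finset (Sym2 V)} (h : A ⊆ edgesIn G W) :
    spanGraph A ≤ restrictTo G W := fun u v hadj =>
  mk_mem_edgesIn.1 (h (by simpa using ((SimpleGraph.fromEdgeSet_adj _).1 hadj).1))

theorem edgesIn_eq_union {W : Finset V} {x : V} (hx : x ∈ W) :
    edgesIn G W = edgesIn G (W.erase x) ∪ (neighborsIn G W x).image fun y => s(x, y) := by
  ext e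
  induction e with
  | h u v =>
    simp only [Finset.mem_union, mk_mem_edgesIn, Finset.mem_image, neighborsIn, Finset.mem_filter,
      restrictTo, Finset.mem_erase, Sym2.eq_iff]
    constructor
    · rintro ⟨h, hu, hv⟩
      by_cases h1 : u = x
      · subst h1
        exact Or.inr ⟨v, ⟨hv, h⟩, Or.inl ⟨rfl, rfl⟩⟩
      · by_cases h2 : v = x
        · subst h2
          exact Or.inr ⟨u, ⟨hu, h.symm⟩, Or.inr ⟨rfl, rfl⟩⟩
        · exact Or.inl ⟨h, ⟨h1, hu⟩, h2, hv⟩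
    · rintro (⟨h, h1, h2⟩ | ⟨y, ⟨hy, h⟩, ⟨rfl, rfl⟩ | ⟨rfl, rfl⟩⟩)
      · exact ⟨h, h1.2, h2.2⟩
      · exact ⟨h, hx, hy⟩
      · exact ⟨h.symm, hy, hx⟩

theorem sum_powerset_union {α : Type*} [DecidableEq α] {M : Type*} [AddCommMonoid M] {S T : Finset α}
    (h : Disjoint S T) (F : Finset α → M) :
    ∑ A ∈ (S ∪ T).powerset, F A = ∑ A ∈ S.powerset, ∑ B ∈ T.powerset, F (A ∪ B) := by
  rw [← Finset.sum_product']
  refine Finset.sum_nbij' (fun A => (A ∩ S, A ∩ T)) (fun p => p.1 ∪ p.2) ?_ ?_ ?_ ?_ ?_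
  · intro A _
    simp
  · intro p hp
    simp only [Finset.mem_product, Finset.mem_powerset] at hp ⊢
    exact Finset.union_subset_union hp.1 hp.2
  · intro A hA
    rw [← Finset.inter_union_distrib_left]
    exact Finset.inter_eq_left.2 (Finset.mem_powerset.1 hA)
  · rintro ⟨A, B⟩ hp
    simp only [Finset.mem_product, Finset.mem_powerset] at hp
    have h1 : B ∩ S = ∅ :=
      Finset.disjoint_iff_inter_eq_empty.1 (Finset.disjoint_of_subset_left hp.2 h.symm)
    have h2 : A ∩ T = ∅ :=
      Finset.disjoint_iff_inter_eq_empty.1 (Finset.disjoint_of_subset_left hp.1 h)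
    simp [Finset.union_inter_distrib_right, h1, h2, Finset.inter_eq_left.2 hp.1,
      Finset.inter_eq_left.2 hp.2]
  · intro A hA
    rw [← Finset.inter_union_distrib_left, Finset.inter_eq_left.2 (Finset.mem_powerset.1 hA)]

/-- Edge sets that miss the vertex `x` and edge sets at `x`. -/
theorem reachable_union_iff {W : Finset V} {x b : V} (hxb : b ≠ x) {A B : Finset (Sym2 V)}
    (hA : A ⊆ edgesIn G (W.erase x)) (hB : B ⊆ (neighborsIn G W x).image fun y => s(x, y)) :
    (¬ (spanGraph (A ∪ B)).Reachable b x ↔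
      ∀ y, s(x, y) ∈ B → ¬ (spanGraph A).Reachable b y) ∧
    (¬ (spanGraph (A ∪ B)).Reachable b x →
      ∀ w, (spanGraph (A ∪ B)).Reachable b w ↔ (spanGraph A).Reachable b w) := by
  have hmono : spanGraph A ≤ spanGraph (A ∪ B) :=
    SimpleGraph.fromEdgeSet_mono (by simp)
  have hne : ∀ y, s(x, y) ∈ B → x ≠ y := by
    intro y hy
    obtain ⟨z, hz, he⟩ := Finset.mem_image.1 (hB hy)
    have := (Finset.mem_filter.1 hz).2.ne
    rcases Sym2.eq_iff.1 he with ⟨_, h⟩ | ⟨h1, h2⟩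
    · rwa [← h]
    · rw [h2, h1] at this
      exact (this rfl).elim
  have hx : ∀ w, (spanGraph A).Reachable b w → w ≠ x := by
    intro w hw
    refine mem_of_reachable (S := {w | w ≠ x}) (fun u v hadj _ => ?_) hw hxb
    exact (Finset.mem_erase.1 (spanGraph_le_restrictTo hA hadj).2.2).1
  have key : (∀ y, s(x, y) ∈ B → ¬ (spanGraph A).Reachable b y) →
      ∀ w, (spanGraph (A ∪ B)).Reachable b w → (spanGraph A).Reachable b w := by
    intro h w hw
    refine mem_of_reachable (S := {w | (spanGraph A).Reachable b w}) (fun u v hadj hu => ?_) hw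
      (SimpleGraph.Reachable.refl b)
    rw [SimpleGraph.fromEdgeSet_adj] at hadj
    rcases Finset.mem_union.1 (by simpa using hadj.1) with h1 | h1
    · exact SimpleGraph.Reachable.trans hu (SimpleGraph.Adj.reachable
        ((SimpleGraph.fromEdgeSet_adj _).2 ⟨by simpa using h1, hadj.2⟩))
    · obtain ⟨z, hz, he⟩ := Finset.mem_image.1 (hB h1)
      rcases Sym2.eq_iff.1 he with ⟨h2, _⟩ | ⟨h2, h3⟩
      · exact absurd h2.symm (hx u hu)
      · subst h2 h3
        exact absurd hu (h _ (by rwa [Sym2.eq_swap]))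
  have first : ¬ (spanGraph (A ∪ B)).Reachable b x ↔
      ∀ y, s(x, y) ∈ B → ¬ (spanGraph A).Reachable b y := by
    constructor
    · intro h y hy hr
      refine h ((hr.mono hmono).trans (SimpleGraph.Adj.reachable ?_))
      rw [SimpleGraph.fromEdgeSet_adj]
      exact ⟨by rw [Sym2.eq_swap]; simp [hy], (hne y hy).symm⟩
    · intro h hr
      exact hx x (key h x hr) rfl
  exact ⟨first, fun h w => ⟨key (first.1 h) w, fun h => h.mono hmono⟩⟩

/-- The difference of the first two sums runs over the sets that do not connect `b` to `x`. Split
such a set into `A`, missing `x`, and `B`, a set of edges at `x` avoiding the component of `b` in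
`A`. For fixed `A` the alternating sum over `B` vanishes unless no edge is available, that is,
unless `A` connects `b` to every neighbour of `x` in `W`. -/
theorem rootedSum_insert {b x : V} (hxb : b ≠ x) {W N : Finset V} (hx : x ∈ W) :
    rootedSum G b W N =
      rootedSum G b W (insert x N) + rootedSum G b (W.erase x) (N ∪ neighborsIn G W x) := by
  have hdisj : Disjoint (edgesIn G (W.erase x))
      ((neighborsIn G W x).image fun y => s(x, y)) := by
    rw [Finset.disjoint_left]
    intro e he he'
    obtain ⟨y, _, rfl⟩ := Finset.mem_image.1 he'
    simpa [restrictTo] using (mk_mem_edgesIn.1 he).2.1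
  rw [← sub_eq_iff_eq_add', rootedSum, rootedSum, ← Finset.sum_sub_distrib, edgesIn_eq_union hx,
    sum_powerset_union hdisj, rootedSum]
  refine Finset.sum_congr rfl fun A hA => ?_
  have hA' := Finset.mem_powerset.1 hA
  set T := (neighborsIn G W x).image fun y => s(x, y) with hT
  -- `T'` consists of the edges at `x` that do not lead to the component of `b` in `A`; the
  -- admissible `B` are exactly its subsets.
  set T' := T.filter fun e => ∀ y, e = s(x, y) → ¬ (spanGraph A).Reachable b y with hT'
  have step : ∀ B ∈ T.powerset,
      ((if ∀ n ∈ N, (spanGraph (A ∪ B)).Reachable b n then (-1 : ℤ) ^ (A ∪ B).card else 0) -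
        if ∀ n ∈ insert x N, (spanGraph (A ∪ B)).Reachable b n then (-1) ^ (A ∪ B).card else 0) =
      if B ∈ T'.powerset then (if ∀ n ∈ N, (spanGraph A).Reachable b n then (-1) ^ A.card else 0) *
        (-1) ^ B.card else 0 := by
    intro B hB
    have hB' := Finset.mem_powerset.1 hB
    obtain ⟨h1, h2⟩ := reachable_union_iff hxb hA' hB'
    have hcard : (A ∪ B).card = A.card + B.card :=
      Finset.card_union_of_disjoint (Finset.disjoint_of_subset_left hA'
        (Finset.disjoint_of_subset_right hB' hdisj))
    have hmem : B ∈ T'.powerset ↔ ¬ (spanGraph (A ∪ B)).Reachable b x := by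
      rw [h1, Finset.mem_powerset]
      constructor
      · intro h y hy
        exact (Finset.mem_filter.1 (h hy)).2 y rfl
      · intro h e he
        refine Finset.mem_filter.2 ⟨hB' he, fun y hy => h y (hy ▸ he)⟩
    by_cases hr : (spanGraph (A ∪ B)).Reachable b x
    · have hB'' : B ∉ T'.powerset := fun h => hmem.1 h hr
      rw [if_neg hB'']
      simp [hr]
    · rw [if_pos (hmem.2 hr)]
      simp only [h2 hr, Finset.forall_mem_insert]
      simp [pow_add, hcard, ← h2 hr x, hr]
  rw [Finset.sum_congr rfl step, ← Finset.sum_filter, Finset.filter_mem_eq_inter,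
    Finset.inter_eq_right.2 (Finset.powerset_mono.2 (Finset.filter_subset _ _)),
    ← Finset.mul_sum, Finset.sum_powerset_neg_one_pow_card]
  have hempty : T' = ∅ ↔ ∀ y ∈ neighborsIn G W x, (spanGraph A).Reachable b y := by
    rw [hT', Finset.filter_eq_empty_iff]
    constructor
    · intro h y hy
      have := h (Finset.mem_image_of_mem _ hy)
      push Not at this
      obtain ⟨z, hz, hr⟩ := this
      rcases Sym2.eq_iff.1 hz with ⟨_, h⟩ | ⟨h, h'⟩
      · rwa [h]
      · rwa [h', h]
    · intro h e he hcon
      obtain ⟨y, hy, rfl⟩ := Finset.mem_image.1 he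
      exact hcon y rfl (h y hy)
  simp only [Finset.mem_union, or_imp, forall_and]
  split_ifs <;> simp_all

/-- The alternating sum vanishes if some required vertex cannot be reached at all. -/
theorem rootedSum_eq_zero {b n : V} {W N : Finset V} (hn : n ∈ N)
    (h : ¬ (restrictTo G W).Reachable b n) : rootedSum G b W N = 0 := by
  refine Finset.sum_eq_zero fun A hA => if_neg fun hcon => h ?_
  exact (hcon n hn).mono (spanGraph_le_restrictTo (Finset.mem_powerset.1 hA))

theorem rootedSum_empty {b : V} {W : Finset V} :
    rootedSum G b W ∅ = if edgesIn G W = ∅ then 1 else 0 := by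
  simp [rootedSum, Finset.sum_powerset_neg_one_pow_card]

theorem rootedSum_insert_self {b : V} {W N : Finset V} :
    rootedSum G b W (insert b N) = rootedSum G b W N := by
  simp [rootedSum]

/-- The sign of the alternating sum, and its nonvanishing. -/
theorem rootedSum_sign {b : V} (k : ℕ) : ∀ W : Finset V, W.card = k → b ∈ W →
    (∀ w ∈ W, (restrictTo G W).Reachable b w) → ∀ N : Finset V, N ⊆ W →
      0 ≤ (-1) ^ (W.card + 1) * rootedSum G b W N ∧
      (IsGuarded G b W N → 0 < (-1) ^ (W.card + 1) * rootedSum G b W N) := by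
  induction k with
  | zero =>
    intro W hW hb
    rw [Finset.card_eq_zero.1 hW] at hb
    simp at hb
  | succ k ihk =>
    intro W hW hb hconn N
    induction N using Finset.induction_on with
    | empty =>
      intro _
      rw [rootedSum_empty]
      by_cases hWb : W = {b}
      · subst hWb
        have : edgesIn G {b} = ∅ := by
          rw [Finset.eq_empty_iff_forall_notMem]
          intro e
          induction e with
          | h u v =>
            rw [mk_mem_edgesIn]
            rintro ⟨h, hu, hv⟩
            rw [Finset.mem_singleton] at hu hv
            exact h.ne (hu.trans hv.symm)
        simp [this]
      · obtain ⟨w, hw, hwb⟩ : ∃ w ∈ W, w ≠ b := by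
          by_contra! hcon
          exact hWb (Finset.eq_singleton_iff_unique_mem.2 ⟨hb, hcon⟩)
        have hE : edgesIn G W ≠ ∅ := by
          intro hE
          refine hwb ?_
          refine mem_of_reachable (S := {b}) (fun u v hadj _ => ?_) (hconn w hw) rfl
          simpa [hE] using mk_mem_edgesIn.2 hadj
        rw [if_neg hE]
        -- With `N` empty the sole guard is `b`, and removing `v = b` leaves the vertex `w`
        -- unguarded.
        refine ⟨by simp, fun hg => ?_⟩
        obtain ⟨z, hz, hzb, _⟩ := hg b hb w hw hwb
        exact absurd (by simpa using hz) hzb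
    | insert x N hxN ihN =>
      intro hN
      have hN' : N ⊆ W := (Finset.subset_insert x N).trans hN
      have hx : x ∈ W := hN (Finset.mem_insert_self x N)
      obtain ⟨ih1, ih2⟩ := ihN hN'
      by_cases hxb : b = x
      · subst hxb
        rw [rootedSum_insert_self]
        refine ⟨ih1, fun hg => ih2 ?_⟩
        simpa [IsGuarded] using hg
      have hcard : W.card = (W.erase x).card + 1 := (Finset.card_erase_add_one hx).symm
      have hsplit : (-1) ^ (W.card + 1) * rootedSum G b W (insert x N) =
          (-1) ^ (W.card + 1) * rootedSum G b W N + (-1) ^ ((W.erase x).card + 1) *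
            rootedSum G b (W.erase x) (N ∪ neighborsIn G W x) := by
        rw [rootedSum_insert hxb hx (N := N), hcard]
        ring
      rw [hsplit]
      -- If `W \ x` is connected, the second summand carries the strict sign by induction on the
      -- size of `W`. Otherwise it vanishes, and guardedness passes to `N` in the first summand.
      by_cases hc : ∀ w ∈ W.erase x, (restrictTo G (W.erase x)).Reachable b w
      · have hsub : N ∪ neighborsIn G W x ⊆ W.erase x := by
          refine Finset.union_subset (fun n hn => ?_) fun n hn => ?_
          · refine Finset.mem_erase.2 ⟨?_, hN' hn⟩
            rintro rfl
            exact hxN hn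
          · have := Finset.mem_filter.1 hn
            exact Finset.mem_erase.2 ⟨this.2.ne', this.1⟩
        obtain ⟨h1, h2⟩ := ihk (W.erase x) (by omega) (Finset.mem_erase.2 ⟨hxb, hb⟩) hc _ hsub
        exact ⟨add_nonneg ih1 h1, fun hg => add_pos_of_nonneg_of_pos ih1 (h2 hg.erase)⟩
      · push Not at hc
        obtain ⟨w₀, hw₀, hnot⟩ := hc
        -- If every neighbour of `x` were reachable from `b` in `W \ x`, then so would be all of `W
        -- \ x`, since `W` is connected.
        obtain ⟨y, hy, hyr⟩ : ∃ y ∈ neighborsIn G W x,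
            ¬ (restrictTo G (W.erase x)).Reachable b y := by
          by_contra! hcon
          have := mem_of_reachable
            (S := {u | u = x ∨ (restrictTo G (W.erase x)).Reachable b u})
            (fun u v hadj hu => ?_) (hconn w₀ (Finset.mem_erase.1 hw₀).2)
            (Or.inr (SimpleGraph.Reachable.refl b))
          · rcases this with h | h
            · exact (Finset.mem_erase.1 hw₀).1 h
            · exact hnot h
          · by_cases hvx : v = x
            · exact Or.inl hvx
            · by_cases hux : u = x
              · subst hux
                exact Or.inr (hcon v (Finset.mem_filter.2 ⟨hadj.2.2, hadj.1⟩))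
              · exact Or.inr ((hu.resolve_left hux).trans (SimpleGraph.Adj.reachable
                  ⟨hadj.1, Finset.mem_erase.2 ⟨hux, hadj.2.1⟩,
                    Finset.mem_erase.2 ⟨hvx, hadj.2.2⟩⟩))
        rw [rootedSum_eq_zero (Finset.mem_union_right N hy) hyr, mul_zero, add_zero]
        exact ⟨ih1, fun hg => ih2 (hg.of_insert hb hxb hx hconn hw₀ hnot)⟩

/-- In a `2`-connected graph, the alternating number of edge sets that connect two given vertices
is not zero. -/
theorem rootedSum_ne_zero [Fintype V] (h2 : TwoConnected G) {a b : V} (hab : a ≠ b) :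
    rootedSum G b Finset.univ {a} ≠ 0 := by
  have hconn : ∀ w ∈ (Finset.univ : Finset V), (restrictTo G Finset.univ).Reachable b w := by
    intro w _
    exact (h2.2.1.preconnected b w).mono fun u v h => ⟨h, Finset.mem_univ _, Finset.mem_univ _⟩
  -- Removing `v` leaves a connected graph that still contains at least one of `a` and `b`.
  have hg : IsGuarded G b Finset.univ {a} := by
    intro v _ w _ hwv
    have key : ∀ z, z ≠ v → (restrictTo G (Finset.univ.erase v)).Reachable w z := by
      intro z hz
      have := (h2.2.2 v).preconnected ⟨w, hwv⟩ ⟨z, hz⟩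
      let f : G.induce {v}ᶜ →g restrictTo G (Finset.univ.erase v) :=
        ⟨Subtype.val, fun {x y} h => ⟨h, Finset.mem_erase.2 ⟨x.2, Finset.mem_univ _⟩,
          Finset.mem_erase.2 ⟨y.2, Finset.mem_univ _⟩⟩⟩
      exact this.map f
    by_cases hva : v = a
    · exact ⟨b, by simp, by rw [hva]; exact hab.symm, Finset.mem_univ _,
        key b (by rw [hva]; exact hab.symm)⟩
    · exact ⟨a, by simp, Ne.symm hva, Finset.mem_univ _, key a (Ne.symm hva)⟩
  intro h0
  have := (rootedSum_sign _ Finset.univ rfl (Finset.mem_univ b) hconn {a}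
    (Finset.subset_univ _)).2 hg
  simp [h0] at this

/-- In a `2`-connected graph, the alternating number of edge sets that do not connect two given
vertices is not zero. -/
theorem sum_not_connecting_ne_zero (h2 : TwoConnected G) {a b : V} (hab : a ≠ b) :
    ∑ A ∈ (edges G).powerset with compOf A a ≠ compOf A b, (-1 : ℤ) ^ A.card ≠ 0 := by
  have : Fintype V := Fintype.ofFinite V
  have hE : edgesIn G Finset.univ = edges G := by simp [edgesIn]
  have hne : edges G ≠ ∅ := by
    intro h
    refine hab ?_
    refine mem_of_reachable (S := {b}) (fun u v hadj _ => ?_) (h2.2.1.preconnected b a) rfl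
    simpa [h] using mk_mem_edges.2 hadj
  -- The alternating sum over all edge sets vanishes, so the connecting and the non-connecting sets
  -- contribute opposite values.
  have h0 : ∑ A ∈ (edges G).powerset, (-1 : ℤ) ^ A.card = 0 := by
    rw [Finset.sum_powerset_neg_one_pow_card, if_neg hne]
  have h1 := rootedSum_ne_zero h2 hab
  simp only [rootedSum, hE, Finset.mem_singleton, forall_eq] at h1
  rw [← Finset.sum_filter] at h1
  rw [← Finset.sum_filter_add_sum_filter_not _ fun A => compOf A a ≠ compOf A b] at h0
  have h3 : ((edges G).powerset.filter fun A => ¬ compOf A a ≠ compOf A b) =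
      (edges G).powerset.filter fun A => (spanGraph A).Reachable b a := by
    refine Finset.filter_congr fun A _ => ?_
    rw [not_not, SimpleGraph.ConnectedComponent.eq]
    exact ⟨fun h => h.symm, fun h => h.symm⟩
  intro hcon
  rw [hcon, zero_add, h3] at h0
  exact h1 h0

end Alternating

/-! ## The conditional partition functions as polynomials in `y` -/

section Conditional

open Classical

variable {V : Type u} [Finite V] {G : SimpleGraph V}

theorem card_edges (G : SimpleGraph V) : (edges G).card = Nat.card G.edgeSet := by
  rw [edges, ← Set.ncard_eq_toFinset_card]
  rfl

theorem compOf_edges_eq (hG : G.Connected) (u v : V) :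
    compOf (edges G) u = compOf (edges G) v := by
  rw [SimpleGraph.ConnectedComponent.eq]
  exact (hG.preconnected u v).mono fun x y h => (SimpleGraph.fromEdgeSet_adj _).2
    ⟨by simpa using mk_mem_edges.2 h, h.ne⟩

theorem freeComps_edges (hG : G.Connected) (a b : V) : freeComps (edges G) a b = 0 := by
  rw [freeComps, Nat.card_eq_zero]
  refine Or.inl ⟨fun c => c.2 ?_⟩
  obtain ⟨c, hc⟩ := c
  induction c using SimpleGraph.ConnectedComponent.ind with
  | h v => exact Or.inl (compOf_edges_eq hG v a)

theorem term_degree_lt {A : Finset (Sym2 V)} (hA : A ∈ (edges G).powerset.erase (edges G))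
    (m : ℕ) : (qVar ^ m * (yVar - 1) ^ A.card).degree < ((edges G).card : WithBot ℕ) := by
  obtain ⟨h1, h2⟩ := Finset.mem_erase.1 hA
  have hlt : A.card < (edges G).card :=
    Finset.card_lt_card ((Finset.mem_powerset.1 h2).ssubset_of_ne h1)
  have h3 : (yVar - 1 : Poly2 ℂ) = X - C 1 := by simp [yVar]
  rw [qVar, ← C_pow, h3]
  rw [degree_C_mul (pow_ne_zero m X_ne_zero), degree_pow, degree_X_sub_C]
  simpa using hlt

/-- The full edge set is the only one of top degree, and it is excluded because it connects `a` and
`b`. -/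
theorem condDiff_degree_lt (hG : G.Connected) (a b : V) :
    (condDiff G a b).degree < ((edges G).card : WithBot ℕ) := by
  rw [condDiff, ← mem_degreeLT]
  refine Submodule.sum_mem _ fun A hA => ?_
  rw [mem_degreeLT]
  obtain ⟨h1, h2⟩ := Finset.mem_filter.1 hA
  refine term_degree_lt (Finset.mem_erase.2 ⟨?_, h1⟩) _
  rintro rfl
  exact h2 (compOf_edges_eq hG a b)

theorem condSame_eq (hG : G.Connected) (a b : V) : ∃ r : Poly2 ℂ,
    r.degree < ((edges G).card : WithBot ℕ) ∧
      condSame G a b = (X - C 1) ^ (edges G).card + r := by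
  refine ⟨∑ A ∈ (edges G).powerset.erase (edges G),
    qVar ^ freeComps A a b * (yVar - 1) ^ A.card, ?_, ?_⟩
  · rw [← mem_degreeLT]
    refine Submodule.sum_mem _ fun A hA => ?_
    rw [mem_degreeLT]
    exact term_degree_lt hA _
  · rw [condSame, ← Finset.add_sum_erase _ _ (Finset.mem_powerset_self (edges G)),
      freeComps_edges hG]
    simp [yVar]

theorem condSame_monic (hG : G.Connected) (a b : V) : (condSame G a b).Monic := by
  obtain ⟨r, hr, h⟩ := condSame_eq hG a b
  rw [h]
  refine ((monic_X_sub_C 1).pow _).add_of_left ?_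
  rwa [degree_pow, degree_X_sub_C, nsmul_one]

theorem condSame_natDegree (hG : G.Connected) (a b : V) :
    (condSame G a b).natDegree = (edges G).card := by
  obtain ⟨r, hr, h⟩ := condSame_eq hG a b
  rw [h, natDegree_add_eq_left_of_degree_lt, natDegree_pow, natDegree_X_sub_C, mul_one]
  rwa [degree_pow, degree_X_sub_C, nsmul_one]

/-- At `q = 1` every component has weight one, and what remains is the binomial expansion of `((y -
1) + 1) ^ |E|`. -/
theorem condSame_map_one (G : SimpleGraph V) (a b : V) :
    (condSame G a b).map (evalRingHom 1) = X ^ (edges G).card := by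
  have h := Finset.sum_pow_mul_eq_add_pow (X - 1 : ℂ[X]) 1 (edges G)
  simp only [one_pow, mul_one, sub_add_cancel] at h
  rw [condSame, ← h, Polynomial.map_sum]
  refine Finset.sum_congr rfl fun A _ => ?_
  simp [qVar, yVar]

theorem condDiff_map_one_coeff (h2 : TwoConnected G) {a b : V} (hab : a ≠ b) :
    ((condDiff G a b).map (evalRingHom 1)).coeff 0 ≠ 0 := by
  have h := sum_not_connecting_ne_zero h2 hab
  rw [← Int.cast_ne_zero (α := ℂ)] at h
  convert h using 1
  rw [coeff_zero_eq_eval_zero, condDiff, Polynomial.map_sum, eval_finsetSum, Int.cast_sum]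
  refine Finset.sum_congr rfl fun A _ => ?_
  simp [qVar, yVar]

theorem edges_nonempty (h2 : TwoConnected G) {a b : V} (hab : a ≠ b) : (edges G).card ≠ 0 := by
  intro h
  have h0 := h2.2.1.preconnected a b
  refine hab (mem_of_reachable (S := {a}) (fun u v hadj _ => ?_) h0 rfl).symm
  simpa [Finset.card_eq_zero.1 h] using mk_mem_edges.2 hadj

/-- The resultant with respect to `y` of the two conditional partition functions. -/
def condResultant (G : SimpleGraph V) (a b : V) : ℂ[X] :=
  resultant (condSame G a b) (condDiff G a b) (edges G).card (edges G).card

/-- It suffices to specialize to `q = 1`, where the first polynomial is a power of `y`: the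
resultant then reduces to a power of the constant term of the second. -/
theorem condResultant_ne_zero (h2 : TwoConnected G) {a b : V} (hab : a ≠ b) :
    condResultant G a b ≠ 0 := by
  intro h
  have h1 := resultant_map_map (condSame G a b) (condDiff G a b) (edges G).card (edges G).card
    (evalRingHom (1 : ℂ))
  rw [condSame_map_one, resultant_X_pow_left _ _ _ (natDegree_map_le.trans
    (natDegree_le_of_degree_le (condDiff_degree_lt h2.2.1 a b).le))] at h1
  rw [condResultant] at h
  rw [h, map_zero] at h1
  exact condDiff_map_one_coeff h2 hab (pow_eq_zero_iff (edges_nonempty h2 hab) |>.1 h1)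

/-- The degree bounds on the cofactors allow the identity to be homogenized in degree `2|E|`. -/
theorem exists_bezout (h2 : TwoConnected G) {a b : V} (hab : a ≠ b) : ∃ p q : Poly2 ℂ,
    p.natDegree ≤ (edges G).card ∧ q.natDegree ≤ (edges G).card ∧
      condSame G a b * p + condDiff G a b * q = C (condResultant G a b) := by
  obtain ⟨p, q, hp, hq, h⟩ := exists_mul_add_mul_eq_C_resultant (condSame G a b) (condDiff G a b)
    (condSame_natDegree h2.2.1 a b).le
    (natDegree_le_of_degree_le (condDiff_degree_lt h2.2.1 a b).le)
    (Or.inl (edges_nonempty h2 hab))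
  exact ⟨p, q, natDegree_le_of_degree_le hp.le, natDegree_le_of_degree_le hq.le, h⟩

/-- A common divisor of a monic polynomial and a nonzero polynomial in `q` is a unit. -/
theorem isUnit_of_dvd_monic {k : Type*} [Field k] {P D : Poly2 k} {c : k[X]} (hP : P.Monic)
    (hc : c ≠ 0) (h1 : D ∣ P) (h2 : D ∣ C c) : IsUnit D := by
  have hdeg : D.natDegree = 0 := by
    have := natDegree_le_of_dvd h2 (C_ne_zero.2 hc)
    simpa using this
  rw [eq_C_of_natDegree_eq_zero hdeg] at h1 ⊢
  rw [C_dvd_iff_dvd_coeff] at h1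
  have := h1 P.natDegree
  rw [hP.coeff_natDegree] at this
  exact (isUnit_of_dvd_one this).map C

theorem condSame_isRelPrime (h2 : TwoConnected G) {a b : V} (hab : a ≠ b) :
    IsRelPrime (condSame G a b) (condDiff G a b) := by
  intro D h1 h3
  obtain ⟨p, q, _, _, h⟩ := exists_bezout h2 hab
  refine isUnit_of_dvd_monic (condSame_monic h2.2.1 a b) (condResultant_ne_zero h2 hab) h1 ?_
  rw [← h]
  exact dvd_add (h1.mul_right p) (h3.mul_right q)

theorem condDiff_ne_zero (h2 : TwoConnected G) {a b : V} (hab : a ≠ b) :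
    condDiff G a b ≠ 0 := by
  intro h
  apply condDiff_map_one_coeff h2 hab
  simp [h]

end Conditional

/-! ## Degree and field of definition -/

/-- Two reduced fractions with the same value have the same numerator and denominator up to a common
unit. This removes the dependence on the chosen `num` and `den`. -/
theorem exists_unit_of_mul_eq {A : Type*} [CommRing A] [IsDomain A] [DecompositionMonoid A]
    {a b c d : A} (hab : IsRelPrime a b) (hcd : IsRelPrime c d) (hb : b ≠ 0)
    (h : a * d = c * b) : ∃ w : Aˣ, c = a * w ∧ d = b * w := by
  obtain ⟨t, ht⟩ : b ∣ d := hab.symm.dvd_of_dvd_mul_left (h ▸ Dvd.intro_left c rfl)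
  have hc : c = a * t := mul_right_cancel₀ hb (by rw [← h, ht]; ring)
  obtain ⟨w, rfl⟩ : IsUnit t := hcd (hc ▸ Dvd.intro_left a rfl) (ht ▸ Dvd.intro_left b rfl)
  exact ⟨w, hc, ht⟩

theorem exists_num_den_eq {P Q : Poly2 ℂ} (h : IsRelPrime P Q) (hQ : Q ≠ 0) :
    ∃ w : (Poly2 ℂ)ˣ,
      IsFractionRing.num (Poly2 ℂ)
        (algebraMap (Poly2 ℂ) FunField P / algebraMap (Poly2 ℂ) FunField Q) = P * w ∧
      (IsFractionRing.den (Poly2 ℂ)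
        (algebraMap (Poly2 ℂ) FunField P / algebraMap (Poly2 ℂ) FunField Q) : Poly2 ℂ) = Q * w := by
  set f : FunField := algebraMap (Poly2 ℂ) FunField P / algebraMap (Poly2 ℂ) FunField Q with hf
  refine exists_unit_of_mul_eq h (IsFractionRing.num_den_reduced (Poly2 ℂ) f) hQ ?_
  have h1 := IsFractionRing.mk'_num_den' (Poly2 ℂ) f
  have hinj := FaithfulSMul.algebraMap_injective (Poly2 ℂ) FunField
  have hden : algebraMap (Poly2 ℂ) FunField (IsFractionRing.den (Poly2 ℂ) f) ≠ 0 :=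
    IsFractionRing.to_map_ne_zero_of_mem_nonZeroDivisors (IsFractionRing.den (Poly2 ℂ) f).2
  have hQ' : algebraMap (Poly2 ℂ) FunField Q ≠ 0 := by
    rwa [Ne, FaithfulSMul.algebraMap_eq_zero_iff]
  apply hinj
  rw [map_mul, map_mul, eq_comm, ← div_eq_div_iff hden hQ', h1, hf]

theorem mapDegree_div {p q : ℂ[X]} (h : IsCoprime p q) (hq : q ≠ 0) :
    mapDegree (algebraMap ℂ[X] (RatFunc ℂ) p / algebraMap ℂ[X] (RatFunc ℂ) q) =
      max p.natDegree q.natDegree := by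
  set f := algebraMap ℂ[X] (RatFunc ℂ) p / algebraMap ℂ[X] (RatFunc ℂ) q with hf
  have h1 : p * f.denom = f.num * q := by
    apply RatFunc.algebraMap_injective ℂ
    rw [map_mul, map_mul, eq_comm, ← div_eq_div_iff (RatFunc.algebraMap_ne_zero f.denom_ne_zero)
      (RatFunc.algebraMap_ne_zero hq), RatFunc.num_div_denom, hf]
  obtain ⟨w, hw1, hw2⟩ := exists_unit_of_mul_eq h.isRelPrime
    (RatFunc.isCoprime_num_denom f).isRelPrime hq h1
  have hw (r : ℂ[X]) : (r * w).natDegree = r.natDegree := by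
    rcases eq_or_ne r 0 with rfl | hr
    · simp
    · rw [natDegree_mul hr w.ne_zero, natDegree_eq_zero_of_isUnit w.isUnit, add_zero]
  rw [mapDegree, hw1, hw2, hw, hw]

theorem specialize_div {P Q : Poly2 ℂ} (h : IsRelPrime P Q) (hQ : Q ≠ 0) (q₀ : ℂ) :
    specialize (algebraMap (Poly2 ℂ) FunField P / algebraMap (Poly2 ℂ) FunField Q) q₀ =
      algebraMap ℂ[X] (RatFunc ℂ) (P.map (evalRingHom q₀)) /
        algebraMap ℂ[X] (RatFunc ℂ) (Q.map (evalRingHom q₀)) := by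
  obtain ⟨w, h1, h2⟩ := exists_num_den_eq h hQ
  have hw : algebraMap ℂ[X] (RatFunc ℂ) ((w : Poly2 ℂ).map (evalRingHom q₀)) ≠ 0 :=
    (((w.isUnit.map (mapRingHom (evalRingHom q₀))).map (algebraMap ℂ[X] (RatFunc ℂ)))).ne_zero
  rw [specialize]
  simp only [h1, h2, Polynomial.map_mul, map_mul]
  rw [mul_div_mul_right _ _ hw]

/-- The exceptional `q₀` are among the roots of the resultant. Elsewhere the Bézout identity
specializes to coprimality, and the monic numerator keeps its degree. -/
theorem hasGenericDegree_migdalKadanoff (Γ : TwoPointGraph.{u}) (h2 : TwoConnected Γ.graph) :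
    HasGenericDegree (migdalKadanoff Γ) (Nat.card Γ.graph.edgeSet) := by
  rw [← card_edges]
  have hR := condResultant_ne_zero h2 Γ.a_ne_b
  refine (condResultant Γ.graph Γ.a Γ.b).roots.toFinset.finite_toSet.subset fun q₀ hq₀ => ?_
  by_contra hroot
  refine hq₀ ?_
  have hr : (condResultant Γ.graph Γ.a Γ.b).eval q₀ ≠ 0 := by
    simpa [hR] using hroot
  set P := (condSame Γ.graph Γ.a Γ.b).map (evalRingHom q₀) with hP
  set Q := (condDiff Γ.graph Γ.a Γ.b).map (evalRingHom q₀) with hQ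
  have hPdeg : P.natDegree = (edges Γ.graph).card := by
    rw [hP, (condSame_monic h2.2.1 _ _).natDegree_map, condSame_natDegree h2.2.1]
  have hcop : IsCoprime P Q := by
    obtain ⟨p, q, _, _, h⟩ := exists_bezout h2 Γ.a_ne_b
    have h' := congrArg (Polynomial.map (evalRingHom q₀)) h
    rw [Polynomial.map_add, Polynomial.map_mul, Polynomial.map_mul, map_C] at h'
    refine ⟨C ((condResultant Γ.graph Γ.a Γ.b).eval q₀)⁻¹ * p.map (evalRingHom q₀),
      C ((condResultant Γ.graph Γ.a Γ.b).eval q₀)⁻¹ * q.map (evalRingHom q₀), ?_⟩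
    rw [mul_assoc, mul_assoc, ← mul_add, mul_comm _ P, mul_comm _ Q, h', ← C_mul,
      coe_evalRingHom, inv_mul_cancel₀ hr, C_1]
  have hQ0 : Q ≠ 0 := by
    intro h0
    rw [h0, isCoprime_zero_right] at hcop
    exact edges_nonempty h2 Γ.a_ne_b (hPdeg ▸ natDegree_eq_zero_of_isUnit hcop)
  rw [migdalKadanoff, specialize_div (condSame_isRelPrime h2 Γ.a_ne_b)
    (condDiff_ne_zero h2 Γ.a_ne_b), mapDegree_div hcop hQ0, hPdeg, max_eq_left]
  exact natDegree_map_le.trans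
    (natDegree_le_of_degree_le (condDiff_degree_lt h2.2.1 _ _).le)

-- The defining sums make sense over `ℚ`. A common factor over `ℚ` becomes a unit over `ℂ`, hence
-- was already a constant.
open Classical in
theorem definedOverRat_migdalKadanoff (Γ : TwoPointGraph.{u}) (h2 : TwoConnected Γ.graph) :
    DefinedOverRat (migdalKadanoff Γ) := by
  set φ : Poly2 ℚ →+* Poly2 ℂ := mapRingHom (mapRingHom (algebraMap ℚ ℂ)) with hφ
  set P : Poly2 ℚ := ∑ A ∈ (edges Γ.graph).powerset,
    C X ^ freeComps A Γ.a Γ.b * (X - 1) ^ A.card with hP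
  set Q : Poly2 ℚ := ∑ A ∈ (edges Γ.graph).powerset with compOf A Γ.a ≠ compOf A Γ.b,
    C X ^ freeComps A Γ.a Γ.b * (X - 1) ^ A.card with hQ
  have hP' : φ P = condSame Γ.graph Γ.a Γ.b := by
    rw [hP, map_sum, condSame]
    exact Finset.sum_congr rfl fun A _ => by simp [hφ, qVar, yVar]
  have hQ' : φ Q = condDiff Γ.graph Γ.a Γ.b := by
    rw [hQ, map_sum, condDiff]
    exact Finset.sum_congr rfl fun A _ => by simp [hφ, qVar, yVar]
  refine ⟨P, Q, ?_, fun D h1 h3 => ?_, ?_⟩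
  · intro h
    rw [h, map_zero] at hQ'
    exact condDiff_ne_zero h2 Γ.a_ne_b hQ'.symm
  · have hu : IsUnit (φ D) := condSame_isRelPrime h2 Γ.a_ne_b
      (hP' ▸ map_dvd φ h1) (hQ' ▸ map_dvd φ h3)
    have hinj : Function.Injective (mapRingHom (algebraMap ℚ ℂ)) :=
      map_injective _ (algebraMap ℚ ℂ).injective
    rw [Polynomial.isUnit_iff] at hu
    obtain ⟨r, hr, hrD⟩ := hu
    have hdeg : D.natDegree = 0 := by
      have := natDegree_map_eq_of_injective hinj D
      rw [← this]
      change (φ D).natDegree = 0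
      rw [← hrD, natDegree_C]
    rw [eq_C_of_natDegree_eq_zero hdeg] at hrD ⊢
    refine IsUnit.map C ?_
    have h4 : r = (D.coeff 0).map (algebraMap ℚ ℂ) := by
      apply C_injective
      rw [hrD, hφ]
      simp
    rw [h4] at hr
    exact (isUnit_map _).1 hr
  · change _ = algebraMap (Poly2 ℂ) FunField (φ P) / algebraMap (Poly2 ℂ) FunField (φ Q)
    rw [hP', hQ', migdalKadanoff]

/-! ## Homogenization -/

/-- The homogenization `v ^ d * P(q, u / v)` of a polynomial `P(q, y)` of degree at most `d`
in `y`. -/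
def homogenize (P : Poly2 ℂ) (d : ℕ) (u v : Poly2 ℂ) : Poly2 ℂ :=
  ∑ i ∈ Finset.range (d + 1), C (P.coeff i) * u ^ i * v ^ (d - i)

theorem map_homogenize {K : Type*} [Field K] (φ : Poly2 ℂ →+* K) {P : Poly2 ℂ} {d : ℕ}
    (hP : P.natDegree ≤ d) (u : Poly2 ℂ) {v : Poly2 ℂ} (hv : φ v ≠ 0) :
    φ (homogenize P d u v) = φ v ^ d * P.eval₂ (φ.comp C) (φ u / φ v) := by
  rw [homogenize, eval₂_eq_sum_range' _ (Nat.lt_succ_of_le hP), Finset.mul_sum, map_sum]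
  refine Finset.sum_congr rfl fun i hi => ?_
  have hid : i ≤ d := Nat.lt_succ_iff.1 (Finset.mem_range.1 hi)
  obtain ⟨k, rfl⟩ := Nat.exists_eq_add_of_le hid
  rw [Nat.add_sub_cancel_left]
  simp only [map_mul, map_pow, RingHom.comp_apply, div_pow]
  field_simp
  ring

theorem evalEval_eq_eval₂ (x y : ℂ) (P : Poly2 ℂ) :
    P.evalEval x y = P.eval₂ (evalRingHom x) y := by
  rw [← eval_map, map_evalRingHom_eval]

theorem evalEval_homogenize {P : Poly2 ℂ} {d : ℕ} (hP : P.natDegree ≤ d) (u : Poly2 ℂ)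
    {v : Poly2 ℂ} {x y : ℂ} (hv : v.evalEval x y ≠ 0) :
    (homogenize P d u v).evalEval x y =
      v.evalEval x y ^ d * P.evalEval x (u.evalEval x y / v.evalEval x y) := by
  have h := map_homogenize (evalEvalRingHom x y) hP u hv
  rw [evalEval_eq_eval₂ x (u.evalEval x y / v.evalEval x y)]
  have hc : (evalEvalRingHom x y).comp C = evalRingHom x := by
    ext <;> simp
  rw [hc] at h
  exact h

theorem evalEval_qVar (x y : ℂ) : qVar.evalEval x y = x := by
  simp [qVar, evalEval]

/-- A polynomial in `q` and `y` that vanishes for all integers `q ≥ 2` is zero. -/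
theorem eq_of_evalEval {P Q : Poly2 ℂ}
    (h : ∀ N : ℕ, 2 ≤ N → ∀ y : ℂ, P.evalEval (N : ℂ) y = Q.evalEval (N : ℂ) y) : P = Q := by
  rw [← sub_eq_zero]
  ext1 i
  rw [coeff_zero]
  -- Each coefficient in `y` is a polynomial in `q` with infinitely many integer roots.
  refine eq_zero_of_infinite_isRoot _ (Set.Infinite.mono ?_
    ((Set.Ici_infinite (2 : ℕ)).image (Nat.cast_injective (R := ℂ)).injOn))
  rintro _ ⟨N, hN, rfl⟩
  have h0 : (P - Q).map (evalRingHom (N : ℂ)) = 0 := by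
    refine Polynomial.funext fun y => ?_
    rw [map_evalRingHom_eval, evalEval_sub, h N hN y, sub_self, eval_zero]
  have h1 := congrArg (fun p => p.coeff i) h0
  simpa using h1

/-! ## Spin configurations on a graph with substituted edges -/

section Substitution

open Classical

theorem place_a {V : Type u} {G : SimpleGraph V} (o : EdgeOrder G) (H : TwoPointGraph.{u})
    (e : G.edgeSet) : place o H e H.a = Sum.inl (o.fst e) := by
  simp [place]

theorem place_b {V : Type u} {G : SimpleGraph V} (o : EdgeOrder G) (H : TwoPointGraph.{u})
    (e : G.edgeSet) : place o H e H.b = Sum.inl (o.snd e) := by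
  simp [place, H.a_ne_b.symm]

theorem place_of_ne {V : Type u} {G : SimpleGraph V} (o : EdgeOrder G) (H : TwoPointGraph.{u})
    (e : G.edgeSet) (w : {w : H.V // w ≠ H.a ∧ w ≠ H.b}) :
    place o H e w = Sum.inr (e, w) := by
  simp [place, w.2]

/-- Either alternative recovers `e` from an edge of its copy: an unmarked vertex carries the label
`e`, and an edge joining both marked vertices is `e` itself. This is why distinct copies share no
edge. -/
theorem mk_place_cases {V : Type u} {G : SimpleGraph V} (o : EdgeOrder G) (H : TwoPointGraph.{u})
    (e : G.edgeSet) {w w' : H.V} (h : w ≠ w') :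
    (∃ p, Sum.inr p ∈ s(place o H e w, place o H e w') ∧ p.1 = e) ∨
      s(place o H e w, place o H e w') = e.1.map Sum.inl := by
  by_cases hw : w ≠ H.a ∧ w ≠ H.b
  · exact Or.inl ⟨(e, ⟨w, hw⟩), by rw [← place_of_ne o H e ⟨w, hw⟩]; simp, rfl⟩
  by_cases hw' : w' ≠ H.a ∧ w' ≠ H.b
  · exact Or.inl ⟨(e, ⟨w', hw'⟩), by rw [← place_of_ne o H e ⟨w', hw'⟩]; simp, rfl⟩
  right
  rw [← o.mk_eq e, Sym2.map_mk]
  by_cases h1 : w = H.a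
  · have h2 : w' = H.b := by
      by_contra h2
      exact hw' ⟨fun h3 => h (h1.trans h3.symm), h2⟩
    rw [h1, h2, place_a, place_b]
  · have h1' : w = H.b := by
      by_contra h2
      exact hw ⟨h1, h2⟩
    have h2 : w' = H.a := by
      by_contra h2
      exact hw' ⟨h2, fun h3 => h (h1'.trans h3.symm)⟩
    rw [h1', h2, place_a, place_b, Sym2.eq_swap]

theorem fst_eq_of_inr_mem {V : Type u} {G : SimpleGraph V} {o : EdgeOrder G}
    {H : TwoPointGraph.{u}} {e : G.edgeSet} {w w' : H.V} {p}
    (h : Sum.inr p ∈ s(place o H e w, place o H e w')) : p.1 = e := by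
  have key : ∀ w, Sum.inr p = place o H e w → p.1 = e := by
    intro w hw
    unfold place at hw
    split_ifs at hw
    rw [Sum.inr.inj hw]
  rcases Sym2.mem_iff.1 h with h | h
  · exact key w h
  · exact key w' h

theorem copy_injective {V : Type u} {G : SimpleGraph V} (o : EdgeOrder G) (H : TwoPointGraph.{u}) :
    Function.Injective fun x : G.edgeSet × H.graph.edgeSet => x.2.1.map (place o H x.1) := by
  rintro ⟨e, f, hf⟩ ⟨e', f', hf'⟩ h
  dsimp only at h
  have hee : e = e' := by
    induction f with
    | h w w' =>
      induction f' with
      | h z z' =>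
        have hw : w ≠ w' := SimpleGraph.Adj.ne hf
        have hz : z ≠ z' := SimpleGraph.Adj.ne hf'
        rw [Sym2.map_mk, Sym2.map_mk] at h
        rcases mk_place_cases o H e hw with ⟨p, hp, hpe⟩ | h1
        · rw [h] at hp
          exact hpe.symm.trans (fst_eq_of_inr_mem hp)
        · rcases mk_place_cases o H e' hz with ⟨p, hp, hpe⟩ | h2
          · rw [← h] at hp
            exact (fst_eq_of_inr_mem hp).symm.trans hpe
          · rw [h1, h2] at h
            exact Subtype.ext (Sym2.map.injective Sum.inl_injective h)
  subst hee
  have := Sym2.map.injective (place_injective o H e) h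
  subst this
  rfl

theorem prod_edges {V : Type u} [Finite V] (G : SimpleGraph V) [Fintype G.edgeSet] {M : Type*}
    [CommMonoid M] (F : Sym2 V → M) : ∏ e ∈ edges G, F e = ∏ e : G.edgeSet, F e :=
  Finset.prod_subtype (edges G) (fun e => by simp [edges]) F

theorem pow_monoEdges_eq_prod {V : Type u} [Finite V] (G : SimpleGraph V) [Fintype G.edgeSet]
    {N : ℕ} (σ : V → Fin N) (y : ℂ) :
    y ^ monoEdges G σ = ∏ e : G.edgeSet, if (e.1.map σ).IsDiag then y else 1 := by
  rw [← prod_edges G fun e => if (e.map σ).IsDiag then y else 1, monoEdges, ← Finset.prod_const,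
    Finset.prod_filter]

variable (Γ : TwoPointGraph.{u}) (o : EdgeOrder Γ.graph) (H : TwoPointGraph.{u}) {N : ℕ}

/-- The inclusion of the copy of `H` that replaces the edge `e`. -/
def copyMap (e : Γ.graph.edgeSet) : H.V → (Γ.subst o H).V := place o H e

/-- The configuration on `Γ.subst o H` given by the spins on `Γ` and those on the unmarked
vertices of the copies of `H`. -/
def glue (τ : Γ.V → Fin N)
    (ω : Γ.graph.edgeSet → {w : H.V // w ≠ H.a ∧ w ≠ H.b} → Fin N) : (Γ.subst o H).V → Fin N :=
  Sum.elim τ fun p => ω p.1 p.2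

theorem edges_subst [Fintype Γ.graph.edgeSet] [Fintype H.graph.edgeSet] :
    edges (Γ.subst o H).graph =
      (Finset.univ : Finset (Γ.graph.edgeSet × H.graph.edgeSet)).image
        fun x => x.2.1.map (copyMap Γ o H x.1) := by
  ext f
  induction f with
  | h x x' =>
    rw [mk_mem_edges, Finset.mem_image]
    constructor
    · rintro ⟨e, w, w', h, rfl, rfl⟩
      exact ⟨(e, ⟨s(w, w'), h⟩), Finset.mem_univ _, rfl⟩
    · rintro ⟨⟨e, f, hf⟩, _, h⟩
      induction f with
      | h w w' =>
        rcases Sym2.eq_iff.1 h with ⟨h1, h2⟩ | ⟨h1, h2⟩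
        · exact ⟨e, w, w', hf, h1, h2⟩
        · exact ⟨e, w', w, SimpleGraph.Adj.symm hf, h2, h1⟩

theorem pow_monoEdges_subst [Fintype Γ.graph.edgeSet] (σ : (Γ.subst o H).V → Fin N)
    (y : ℂ) : y ^ monoEdges (Γ.subst o H).graph σ =
      ∏ e : Γ.graph.edgeSet, y ^ monoEdges H.graph (σ ∘ copyMap Γ o H e) := by
  have : Fintype H.graph.edgeSet := Fintype.ofFinite _
  simp_rw [pow_monoEdges_eq_prod H.graph]
  rw [monoEdges, ← Finset.prod_const, Finset.prod_filter, edges_subst,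
    Finset.prod_image (g := fun x : Γ.graph.edgeSet × H.graph.edgeSet =>
      x.2.1.map (copyMap Γ o H x.1)) (copy_injective o H).injOn, Fintype.prod_prod_type]
  simp_rw [Sym2.map_map]

/-- The configurations on `H` with prescribed marked spins. -/
theorem sum_unmarked [Fintype H.V] (F : (H.V → Fin N) → ℂ) (c d : Fin N) :
    ∑ ω : {w : H.V // w ≠ H.a ∧ w ≠ H.b} → Fin N,
      F (fun w => if ha : w = H.a then c else if hb : w = H.b then d else ω ⟨w, ha, hb⟩) =
    ∑ σ : H.V → Fin N with σ H.a = c ∧ σ H.b = d, F σ := by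
  refine Finset.sum_bij' (fun ω _ w => if ha : w = H.a then c else if hb : w = H.b then d
    else ω ⟨w, ha, hb⟩) (fun σ _ w => σ w) ?_ ?_ ?_ ?_ ?_
  · intro ω _
    simp [H.a_ne_b.symm]
  · intro σ _
    exact Finset.mem_univ _
  · intro ω _
    funext w
    simp [w.2]
  · intro σ hσ
    funext w
    obtain ⟨h1, h2⟩ := (Finset.mem_filter.1 hσ).2
    by_cases ha : w = H.a
    · simp [ha, h1]
    · by_cases hb : w = H.b
      · simp [hb, H.a_ne_b.symm, h2]
      · simp [ha, hb]
  · intro ω _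
    rfl

theorem sum_unmarked_eq (y : ℂ) (c d : Fin N) [Fintype H.V] :
    ∑ ω : {w : H.V // w ≠ H.a ∧ w ≠ H.b} → Fin N, y ^ monoEdges H.graph
      (fun w => if ha : w = H.a then c else if hb : w = H.b then d else ω ⟨w, ha, hb⟩) =
    if c = d then (condSame H.graph H.a H.b).evalEval (N : ℂ) y
      else (condDiff H.graph H.a H.b).evalEval (N : ℂ) y := by
  rw [sum_unmarked H (fun σ => y ^ monoEdges H.graph σ)]
  split_ifs with h
  · subst h
    rw [eval_condSame H.graph H.a H.b N c]
  · rw [eval_condDiff H.graph H.a H.b N c d h]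

/-- Once the spins `τ` on Γ are fixed, the copies of `H` interact only through them. The sum over
unmarked spins factors over the edges of Γ, each factor depending only on whether `τ` agrees at the
two ends. -/
theorem sum_subst [Fintype Γ.V] [Fintype (Γ.subst o H).V] (c d : Fin N) (y : ℂ) :
    ∑ σ : (Γ.subst o H).V → Fin N with σ (Γ.subst o H).a = c ∧ σ (Γ.subst o H).b = d,
      y ^ monoEdges (Γ.subst o H).graph σ =
    ∑ τ : Γ.V → Fin N with τ Γ.a = c ∧ τ Γ.b = d,
      (condSame H.graph H.a H.b).evalEval (N : ℂ) y ^ monoEdges Γ.graph τ *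
        (condDiff H.graph H.a H.b).evalEval (N : ℂ) y ^
          ((edges Γ.graph).card - monoEdges Γ.graph τ) := by
  have : Fintype H.V := Fintype.ofFinite _
  have : Fintype Γ.graph.edgeSet := Fintype.ofFinite _
  let E : ((Γ.subst o H).V → Fin N) ≃ (Γ.V → Fin N) ×
      (Γ.graph.edgeSet → {w : H.V // w ≠ H.a ∧ w ≠ H.b} → Fin N) :=
    (Equiv.sumArrowEquivProdArrow _ _ _).trans
      (Equiv.prodCongr (Equiv.refl _) (Equiv.curry _ _ _))
  have key : ∀ τ : Γ.V → Fin N,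
      ∑ ω : Γ.graph.edgeSet → {w : H.V // w ≠ H.a ∧ w ≠ H.b} → Fin N,
        y ^ monoEdges (Γ.subst o H).graph (glue Γ o H τ ω) =
      (condSame H.graph H.a H.b).evalEval (N : ℂ) y ^ monoEdges Γ.graph τ *
        (condDiff H.graph H.a H.b).evalEval (N : ℂ) y ^
          ((edges Γ.graph).card - monoEdges Γ.graph τ) := by
    intro τ
    have hplace : ∀ (ω : Γ.graph.edgeSet → {w : H.V // w ≠ H.a ∧ w ≠ H.b} → Fin N) e,
        glue Γ o H τ ω ∘ copyMap Γ o H e = fun w => if ha : w = H.a then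
          τ (o.fst e) else if hb : w = H.b then τ (o.snd e) else ω e ⟨w, ha, hb⟩ := by
      intro ω e
      funext w
      change Sum.elim τ (fun p => ω p.1 p.2) (place o H e w) = _
      unfold place
      split_ifs <;> rfl
    simp_rw [pow_monoEdges_subst, hplace]
    -- Distributivity: the sum over families of unmarked configurations is a product of sums, one
    -- per edge.
    have h1 := Finset.prod_univ_sum (R := ℂ) (ι := Γ.graph.edgeSet)
      (fun _ => (Finset.univ : Finset ({w : H.V // w ≠ H.a ∧ w ≠ H.b} → Fin N)))
      (fun e ω => y ^ monoEdges H.graph (fun w => if ha : w = H.a then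
          τ (o.fst e) else if hb : w = H.b then τ (o.snd e) else ω ⟨w, ha, hb⟩))
    rw [Fintype.piFinset_univ] at h1
    rw [← h1]
    simp_rw [sum_unmarked_eq H]
    have h2 : ∀ e : Γ.graph.edgeSet, τ (o.fst e) = τ (o.snd e) ↔ (e.1.map τ).IsDiag := by
      intro e
      rw [← o.mk_eq e, Sym2.map_mk, Sym2.mk_isDiag_iff]
    simp_rw [h2]
    rw [← prod_edges Γ.graph fun e => if (e.map τ).IsDiag then
      (condSame H.graph H.a H.b).evalEval (N : ℂ) y else
      (condDiff H.graph H.a H.b).evalEval (N : ℂ) y, Finset.prod_ite, Finset.prod_const,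
      Finset.prod_const, monoEdges]
    congr 2
    rw [Finset.filter_not, Finset.card_sdiff_of_subset (Finset.filter_subset _ _)]
  have hE : ∀ τ ω, E.symm (τ, ω) = glue Γ o H τ ω := fun τ ω => rfl
  rw [Finset.sum_filter, Finset.sum_filter, ← E.symm.sum_comp, Fintype.sum_prod_type]
  refine Finset.sum_congr rfl fun τ _ => ?_
  rw [← key]
  simp_rw [hE]
  have ha : ∀ ω, glue Γ o H τ ω (Γ.subst o H).a = τ Γ.a := fun ω => rfl
  have hb : ∀ ω, glue Γ o H τ ω (Γ.subst o H).b = τ Γ.b := fun ω => rfl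
  simp_rw [ha, hb]
  split_ifs
  · rfl
  · exact Finset.sum_const_zero

theorem sum_homogeneous [Fintype Γ.V] (S : Finset (Γ.V → Fin N)) {u v : ℂ} (hv : v ≠ 0) :
    ∑ τ ∈ S, u ^ monoEdges Γ.graph τ * v ^ ((edges Γ.graph).card - monoEdges Γ.graph τ) =
      v ^ (edges Γ.graph).card * ∑ τ ∈ S, (u / v) ^ monoEdges Γ.graph τ := by
  rw [Finset.mul_sum]
  refine Finset.sum_congr rfl fun τ _ => ?_
  obtain ⟨k, hk⟩ := Nat.exists_eq_add_of_le
    (show monoEdges Γ.graph τ ≤ (edges Γ.graph).card from Finset.card_filter_le _ _)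
  rw [hk, Nat.add_sub_cancel_left, div_pow]
  field_simp
  ring

variable {Γ}

/-- Two polynomials that agree wherever a nonzero polynomial does not vanish are equal. -/
theorem eq_of_evalEval_of_ne_zero {P Q v : Poly2 ℂ} (hv : v ≠ 0)
    (h : ∀ N : ℕ, 2 ≤ N → ∀ y : ℂ, v.evalEval (N : ℂ) y ≠ 0 →
      P.evalEval (N : ℂ) y = Q.evalEval (N : ℂ) y) : P = Q := by
  refine mul_right_cancel₀ hv (eq_of_evalEval fun N hN y => ?_)
  rw [evalEval_mul, evalEval_mul]
  by_cases h0 : v.evalEval (N : ℂ) y = 0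
  · rw [h0, mul_zero, mul_zero]
  · rw [h N hN y h0]

theorem condSame_subst (hG : Γ.graph.Connected) (hv : condDiff H.graph H.a H.b ≠ 0) :
    condSame (Γ.subst o H).graph (Γ.subst o H).a (Γ.subst o H).b =
      homogenize (condSame Γ.graph Γ.a Γ.b) (edges Γ.graph).card
        (condSame H.graph H.a H.b) (condDiff H.graph H.a H.b) := by
  have : Fintype Γ.V := Fintype.ofFinite _
  have : Fintype (Γ.subst o H).V := Fintype.ofFinite _
  refine eq_of_evalEval_of_ne_zero hv fun N hN y h0 => ?_
  rw [evalEval_homogenize (condSame_natDegree hG _ _).le _ h0,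
    eval_condSame _ _ _ N ⟨0, by omega⟩, eval_condSame _ Γ.a Γ.b N ⟨0, by omega⟩, sum_subst,
    sum_homogeneous _ _ h0]

theorem condDiff_subst (hG : Γ.graph.Connected) (hv : condDiff H.graph H.a H.b ≠ 0) :
    condDiff (Γ.subst o H).graph (Γ.subst o H).a (Γ.subst o H).b =
      homogenize (condDiff Γ.graph Γ.a Γ.b) (edges Γ.graph).card
        (condSame H.graph H.a H.b) (condDiff H.graph H.a H.b) := by
  have : Fintype Γ.V := Fintype.ofFinite _
  have : Fintype (Γ.subst o H).V := Fintype.ofFinite _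
  refine eq_of_evalEval_of_ne_zero hv fun N hN y h0 => ?_
  have hcd : (⟨0, by omega⟩ : Fin N) ≠ ⟨1, by omega⟩ := by simp
  rw [evalEval_homogenize (natDegree_le_of_degree_le (condDiff_degree_lt hG _ _).le) _ h0,
    eval_condDiff _ _ _ N _ _ hcd, eval_condDiff _ Γ.a Γ.b N _ _ hcd, sum_subst,
    sum_homogeneous _ _ h0]

/-- Classify configurations by the spins at the marked vertices: `q` pairs are equal and `q (q - 1)`
are different. -/
theorem partitionFunction_eq : partitionFunction H.graph =
    qVar * (condSame H.graph H.a H.b + (qVar - 1) * condDiff H.graph H.a H.b) := by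
  have : Fintype H.V := Fintype.ofFinite _
  refine eq_of_evalEval fun N _ y => ?_
  have h1 : ∑ σ : H.V → Fin N, y ^ monoEdges H.graph σ = ∑ c : Fin N, ∑ d : Fin N,
      if c = d then (condSame H.graph H.a H.b).evalEval (N : ℂ) y
      else (condDiff H.graph H.a H.b).evalEval (N : ℂ) y := by
    rw [← Finset.sum_fiberwise Finset.univ fun σ => σ H.a]
    refine Finset.sum_congr rfl fun c _ => ?_
    rw [← Finset.sum_fiberwise _ fun σ => σ H.b]
    refine Finset.sum_congr rfl fun d _ => ?_
    rw [Finset.filter_filter]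
    split_ifs with h
    · rw [eval_condSame _ _ _ N c, ← h]
    · rw [eval_condDiff _ _ _ N c d h]
  rw [eval_partitionFunction, h1]
  have h2 : ∀ c d : Fin N, (if c = d then (condSame H.graph H.a H.b).evalEval (N : ℂ) y
      else (condDiff H.graph H.a H.b).evalEval (N : ℂ) y) =
      (condDiff H.graph H.a H.b).evalEval (N : ℂ) y + if c = d then
        (condSame H.graph H.a H.b).evalEval (N : ℂ) y -
          (condDiff H.graph H.a H.b).evalEval (N : ℂ) y else 0 := by
    intro c d
    split_ifs <;> ring
  simp_rw [h2, Finset.sum_add_distrib]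
  simp [evalEval_qVar]
  ring

end Substitution

/-! ### The single edge: `U = y` and `V = 1` -/

theorem eq_a_or_eq_b (v : singleEdge.{u}.V) : v = singleEdge.a ∨ v = singleEdge.b := by
  obtain ⟨v⟩ := v
  fin_cases v
  · exact Or.inl rfl
  · exact Or.inr rfl

theorem singleEdge_adj : singleEdge.{u}.graph.Adj singleEdge.a singleEdge.b :=
  (SimpleGraph.top_adj _ _).2 singleEdge.a_ne_b

theorem edges_singleEdge : edges singleEdge.{u}.graph = {s(singleEdge.a, singleEdge.b)} := by
  ext e
  induction e with
  | h v w =>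
    rw [mk_mem_edges, Finset.mem_singleton]
    constructor
    · intro h
      rcases eq_a_or_eq_b v with rfl | rfl <;> rcases eq_a_or_eq_b w with rfl | rfl
      · exact (h.ne rfl).elim
      · rfl
      · exact Sym2.eq_swap
      · exact (h.ne rfl).elim
    · intro h
      rcases Sym2.eq_iff.1 h with ⟨rfl, rfl⟩ | ⟨rfl, rfl⟩
      · exact singleEdge_adj
      · exact singleEdge_adj.symm

theorem freeComps_singleEdge (A : Finset (Sym2 singleEdge.{u}.V)) :
    freeComps A singleEdge.a singleEdge.b = 0 := by
  rw [freeComps, Nat.card_eq_zero]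
  refine Or.inl ⟨fun c => c.2 ?_⟩
  obtain ⟨c, hc⟩ := c
  induction c using SimpleGraph.ConnectedComponent.ind with
  | h v => rcases eq_a_or_eq_b v with rfl | rfl
           · exact Or.inl rfl
           · exact Or.inr rfl

theorem sum_powerset_singleton {α : Type*} {M : Type*} [AddCommMonoid M] (e : α)
    (F : Finset α → M) : ∑ A ∈ ({e} : Finset α).powerset, F A = F ∅ + F {e} := by
  classical
  have h : ({e} : Finset α).powerset = {∅, {e}} := by
    ext A
    simp [Finset.subset_singleton_iff]
  rw [h, Finset.sum_pair (Finset.singleton_ne_empty e).symm]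

theorem condSame_singleEdge :
    condSame singleEdge.{u}.graph singleEdge.a singleEdge.b = yVar := by
  rw [condSame, edges_singleEdge, sum_powerset_singleton]
  simp [freeComps_singleEdge]

theorem condDiff_singleEdge :
    condDiff singleEdge.{u}.graph singleEdge.a singleEdge.b = 1 := by
  have h1 : compOf (∅ : Finset (Sym2 singleEdge.{u}.V)) singleEdge.a ≠
      compOf ∅ singleEdge.b := by
    rw [Ne, SimpleGraph.ConnectedComponent.eq]
    intro h
    refine singleEdge.{u}.a_ne_b (mem_of_reachable (S := {singleEdge.a}) (fun u v hadj _ => ?_) h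
      rfl).symm
    simp at hadj
  have h2 : compOf {s(singleEdge.a, singleEdge.b)} singleEdge.{u}.a =
      compOf {s(singleEdge.a, singleEdge.b)} singleEdge.b := by
    rw [SimpleGraph.ConnectedComponent.eq]
    exact SimpleGraph.Adj.reachable
      ((SimpleGraph.fromEdgeSet_adj _).2 ⟨by simp, singleEdge.a_ne_b⟩)
  rw [condDiff, Finset.sum_filter, edges_singleEdge, sum_powerset_singleton, if_pos h1, if_neg
    (not_not.2 h2)]
  simp [freeComps_singleEdge]

/-! ## Coprimality of homogenized pairs -/

section Homogeneous

variable {P u v : Poly2 ℂ} {d : ℕ}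

theorem homogenize_term_degree_lt (hv : v.natDegree < u.natDegree) {i : ℕ} (hi : i < d)
    (c : ℂ[X]) : (C c * u ^ i * v ^ (d - i)).degree < ((d * u.natDegree : ℕ) : WithBot ℕ) := by
  refine degree_le_natDegree.trans_lt (Nat.cast_lt.2 ?_)
  obtain ⟨k, rfl⟩ := Nat.exists_eq_add_of_lt hi
  have h1 : (C c * u ^ i * v ^ (i + k + 1 - i)).natDegree ≤
      i * u.natDegree + (k + 1) * v.natDegree := by
    rw [show i + k + 1 - i = k + 1 by omega]
    refine natDegree_mul_le.trans (add_le_add ?_ natDegree_pow_le)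
    refine (natDegree_C_mul_le _ _).trans natDegree_pow_le
  have h2 : (k + 1) * v.natDegree < (k + 1) * u.natDegree :=
    Nat.mul_lt_mul_of_pos_left hv (Nat.succ_pos k)
  calc _ ≤ _ := h1
    _ < i * u.natDegree + (k + 1) * u.natDegree := Nat.add_lt_add_left h2 _
    _ = _ := by ring

theorem homogenize_degree_lt (hv : v.natDegree < u.natDegree)
    (hP : P.degree < (d : WithBot ℕ)) :
    (homogenize P d u v).degree < ((d * u.natDegree : ℕ) : WithBot ℕ) := by
  rw [homogenize, Finset.sum_range_succ, coeff_eq_zero_of_degree_lt hP, C_0, zero_mul, zero_mul,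
    add_zero, ← mem_degreeLT]
  refine Submodule.sum_mem _ fun i hi => ?_
  rw [mem_degreeLT]
  exact homogenize_term_degree_lt hv (Finset.mem_range.1 hi) _

/-- Since `v` has smaller degree than `u`, the term `u ^ d` dominates, and every other term contains
a factor `v`. The first fact gives monicity, the second coprimality. -/
theorem homogenize_eq (hv : v.natDegree < u.natDegree) (hP : P.Monic) (hd : P.natDegree = d) :
    ∃ r : Poly2 ℂ, r.degree < ((d * u.natDegree : ℕ) : WithBot ℕ) ∧ v ∣ r ∧
      homogenize P d u v = u ^ d + r := by
  refine ⟨∑ i ∈ Finset.range d, C (P.coeff i) * u ^ i * v ^ (d - i), ?_, ?_, ?_⟩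
  · rw [← mem_degreeLT]
    refine Submodule.sum_mem _ fun i hi => ?_
    rw [mem_degreeLT]
    exact homogenize_term_degree_lt hv (Finset.mem_range.1 hi) _
  · refine Finset.dvd_sum fun i hi => Dvd.dvd.mul_left (dvd_pow_self v ?_) _
    have := Finset.mem_range.1 hi
    omega
  · have hc : P.coeff d = 1 := hd ▸ hP.coeff_natDegree
    rw [homogenize, Finset.sum_range_succ, hc, Nat.sub_self]
    simp [add_comm]

theorem homogenize_monic (hu : u.Monic) (hv : v.natDegree < u.natDegree) (hP : P.Monic)
    (hd : P.natDegree = d) :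
    (homogenize P d u v).Monic ∧ (homogenize P d u v).natDegree = d * u.natDegree := by
  obtain ⟨r, hr, _, h⟩ := homogenize_eq hv hP hd
  have hdeg : (u ^ d).degree = ((d * u.natDegree : ℕ) : WithBot ℕ) := by
    rw [degree_eq_natDegree (hu.pow d).ne_zero, hu.natDegree_pow]
  rw [h]
  rw [← hdeg] at hr
  refine ⟨(hu.pow d).add_of_left hr, ?_⟩
  rw [natDegree_add_eq_left_of_degree_lt hr, hu.natDegree_pow]

theorem homogenize_isRelPrime {Q p q : Poly2 ℂ} {R : ℂ[X]} (hu : u.Monic)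
    (hv : v.natDegree < u.natDegree) (hv0 : v ≠ 0) (huv : IsRelPrime u v) (hP : P.Monic)
    (hd : P.natDegree = d) (hQ : Q.natDegree ≤ d) (hp : p.natDegree ≤ d) (hq : q.natDegree ≤ d)
    (hR : R ≠ 0) (h : P * p + Q * q = C R) :
    IsRelPrime (homogenize P d u v) (homogenize Q d u v) := by
  have hmonic := (homogenize_monic hu hv hP hd).1
  obtain ⟨r, _, hvr, hr⟩ := homogenize_eq hv hP hd
  rw [UniqueFactorizationMonoid.isRelPrime_iff_no_prime_factors hmonic.ne_zero]
  intro D h1 h2 hD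
  have hinj := FaithfulSMul.algebraMap_injective (Poly2 ℂ) FunField
  have hv' : algebraMap (Poly2 ℂ) FunField v ≠ 0 := by
    rwa [Ne, FaithfulSMul.algebraMap_eq_zero_iff]
  -- The Bézout identity evaluated at `y = u / v` and multiplied by `v ^ (2 * d)`.
  have key : homogenize P d u v * homogenize p d u v + homogenize Q d u v * homogenize q d u v =
      C R * v ^ (d + d) := by
    apply hinj
    rw [map_add, map_mul, map_mul, map_homogenize _ hd.le _ hv', map_homogenize _ hQ _ hv',
      map_homogenize _ hp _ hv', map_homogenize _ hq _ hv', map_mul, map_pow]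
    have h' := congrArg (eval₂ ((algebraMap (Poly2 ℂ) FunField).comp C)
      (algebraMap (Poly2 ℂ) FunField u / algebraMap (Poly2 ℂ) FunField v)) h
    rw [eval₂_add, eval₂_mul, eval₂_mul, eval₂_C, RingHom.comp_apply] at h'
    rw [← h']
    ring
  have h3 : D ∣ C R * v ^ (d + d) := key ▸ dvd_add (h1.mul_right _) (h2.mul_right _)
  rcases hD.dvd_or_dvd h3 with h4 | h4
  -- A prime dividing `R(q)` cannot divide a monic polynomial in `y`. A prime dividing `v` would
  -- divide `u ^ d` modulo `v`, hence `u`.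
  · exact hD.not_isUnit (isUnit_of_dvd_monic hmonic hR h1 h4)
  · have h5 : D ∣ v := hD.dvd_of_dvd_pow h4
    rw [hr, dvd_add_left (h5.trans hvr)] at h1
    exact hD.not_isUnit (huv (hD.dvd_of_dvd_pow h1) h5)

end Homogeneous

/-! ## Divisors -/

theorem factors'_mul {P Q : Poly2 ℂ} (hP : P ≠ 0) (hQ : Q ≠ 0) :
    Associates.factors' (P * Q) = Associates.factors' P + Associates.factors' Q := by
  have h := Associates.factors_mul (Associates.mk P) (Associates.mk Q)
  rw [Associates.mk_mul_mk, Associates.factors_mk _ (mul_ne_zero hP hQ),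
    Associates.factors_mk _ hP, Associates.factors_mk _ hQ] at h
  exact WithTop.coe_injective h

theorem zeroDivisor_mul {P Q : Poly2 ℂ} (hP : P ≠ 0) (hQ : Q ≠ 0) :
    zeroDivisor (P * Q) = zeroDivisor P + zeroDivisor Q := by
  rw [zeroDivisor, factors'_mul hP hQ, Multiset.map_add, Multiset.sum_add]
  rfl

theorem zeroDivisor_congr {P Q : Poly2 ℂ} (h : Associated P Q) :
    zeroDivisor P = zeroDivisor Q := by
  rw [zeroDivisor, zeroDivisor, Associates.factors'_cong h]

theorem zeroDivisor_one : zeroDivisor 1 = 0 := by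
  have h := zeroDivisor_mul (one_ne_zero (α := Poly2 ℂ)) one_ne_zero
  rwa [mul_one, left_eq_add] at h

theorem zeroDivisor_mul_unit (P : Poly2 ℂ) (w : (Poly2 ℂ)ˣ) :
    zeroDivisor (P * w) = zeroDivisor P :=
  zeroDivisor_congr (associated_mul_unit_left P w w.isUnit)

/-- The curve defined by an irreducible polynomial. -/
def curveOf (p : Poly2 ℂ) (hp : Irreducible p) : PrimeDivisor :=
  some ⟨Associates.mk p, Associates.irreducible_mk.2 hp⟩

theorem zeroDivisor_irreducible {p : Poly2 ℂ} (hp : Irreducible p) :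
    zeroDivisor p = Finsupp.single (curveOf p hp) 1 := by
  have h := Associates.factors_self (Associates.irreducible_mk.2 hp)
  rw [Associates.factors_mk _ hp.ne_zero] at h
  have h' : Associates.factors' p = {⟨Associates.mk p, Associates.irreducible_mk.2 hp⟩} :=
    WithTop.coe_injective h
  rw [zeroDivisor, h', Multiset.map_singleton, Multiset.sum_singleton]
  rfl

theorem sum_single_apply (s : Multiset PlaneCurve) (E : PrimeDivisor) :
    0 ≤ (s.map fun p => Finsupp.single (some p : PrimeDivisor) (1 : ℤ)).sum E ∧
      ((s.map fun p => Finsupp.single (some p : PrimeDivisor) (1 : ℤ)).sum E ≠ 0 →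
        ∃ p ∈ s, E = some p) := by
  classical
  induction s using Multiset.induction_on with
  | empty => simp
  | cons p s ih =>
    rw [Multiset.map_cons, Multiset.sum_cons, Finsupp.add_apply, Finsupp.single_apply]
    by_cases h : some p = E
    · rw [if_pos h]
      exact ⟨by linarith [ih.1], fun _ => ⟨p, Multiset.mem_cons_self p s, h.symm⟩⟩
    · rw [if_neg h, zero_add]
      exact ⟨ih.1, fun h0 => (ih.2 h0).imp fun q hq => ⟨Multiset.mem_cons_of_mem hq.1, hq.2⟩⟩

theorem zeroDivisor_nonneg (P : Poly2 ℂ) (E : PrimeDivisor) : 0 ≤ zeroDivisor P E :=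
  (sum_single_apply _ E).1

theorem zeroDivisor_none (P : Poly2 ℂ) : zeroDivisor P none = 0 := by
  by_contra h
  obtain ⟨p, _, hp⟩ := (sum_single_apply _ none).2 h
  exact absurd hp (by simp)

/-- Coprime polynomials have no common curve of zeros. -/
theorem zeroDivisor_eq_zero_of_isRelPrime {P Q : Poly2 ℂ} (hP : P ≠ 0) (hQ : Q ≠ 0)
    (h : IsRelPrime P Q) {E : PrimeDivisor} (hE : zeroDivisor P E ≠ 0) :
    zeroDivisor Q E = 0 := by
  by_contra hE'
  obtain ⟨⟨p, hp⟩, hpP, rfl⟩ := (sum_single_apply _ E).2 hE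
  obtain ⟨⟨p', hp'⟩, hpQ, hEq⟩ := (sum_single_apply _ _).2 hE'
  obtain rfl : p = p' := congrArg Subtype.val (Option.some.inj hEq)
  have h1 := Associates.dvd_of_mem_factors' (hz := hP) hpP
  have h2 := Associates.dvd_of_mem_factors' (hz := hQ) hpQ
  induction p using Quotient.inductionOn with
  | h p =>
    exact (Associates.irreducible_mk.1 hp).not_isUnit
      (h (Associates.mk_dvd_mk.1 h1) (Associates.mk_dvd_mk.1 h2))

/-- The fraction need not be reduced: a common factor cancels in the divisors and in the degrees. -/
theorem principal_div {P Q : Poly2 ℂ} (hP : P ≠ 0) (hQ : Q ≠ 0) :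
    principal (algebraMap (Poly2 ℂ) FunField P / algebraMap (Poly2 ℂ) FunField Q) =
      zeroDivisor P - zeroDivisor Q +
        Finsupp.single none ((Q.natDegree : ℤ) - P.natDegree) := by
  set f : FunField := algebraMap (Poly2 ℂ) FunField P / algebraMap (Poly2 ℂ) FunField Q with hf
  have hinj := FaithfulSMul.algebraMap_injective (Poly2 ℂ) FunField
  have hmap : ∀ {S : Poly2 ℂ}, S ≠ 0 → algebraMap (Poly2 ℂ) FunField S ≠ 0 := fun hS => by
    rwa [Ne, FaithfulSMul.algebraMap_eq_zero_iff]
  set A : Poly2 ℂ := IsFractionRing.num (Poly2 ℂ) f with hA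
  set B : Poly2 ℂ := (IsFractionRing.den (Poly2 ℂ) f : Poly2 ℂ) with hB
  have hB0 : B ≠ 0 := nonZeroDivisors.ne_zero (IsFractionRing.den (Poly2 ℂ) f).2
  have hf0 : f ≠ 0 := div_ne_zero (hmap hP) (hmap hQ)
  have hA0 : A ≠ 0 := by
    rwa [hA, Ne, IsFractionRing.num_eq_zero]
  have hAB : A * Q = P * B := by
    apply hinj
    rw [map_mul, map_mul, ← div_eq_div_iff (hmap hB0) (hmap hQ), hA, hB,
      IsFractionRing.mk'_num_den', hf]
  have h1 : zeroDivisor A + zeroDivisor Q = zeroDivisor P + zeroDivisor B := by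
    rw [← zeroDivisor_mul hA0 hQ, ← zeroDivisor_mul hP hB0, hAB]
  have h2 : A.natDegree + Q.natDegree = P.natDegree + B.natDegree := by
    rw [← natDegree_mul hA0 hQ, ← natDegree_mul hP hB0, hAB]
  have h3 : zeroDivisor A - zeroDivisor B = zeroDivisor P - zeroDivisor Q :=
    sub_eq_sub_iff_add_eq_add.2 h1
  have h4 : (B.natDegree : ℤ) - A.natDegree = (Q.natDegree : ℤ) - P.natDegree := by
    omega
  change zeroDivisor A - zeroDivisor B +
    Finsupp.single none ((B.natDegree : ℤ) - A.natDegree) = _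
  rw [h3, h4]

/-! ## Pullbacks -/

theorem algebraMap_eq_comp_C :
    algebraMap ℂ[X] FunField = (algebraMap (Poly2 ℂ) FunField).comp C :=
  IsScalarTower.algebraMap_eq ℂ[X] (Poly2 ℂ) FunField

theorem substY_unit (s : FunField) (w : (Poly2 ℂ)ˣ) :
    substY s w = algebraMap (Poly2 ℂ) FunField w := by
  obtain ⟨c, _, hc⟩ := Polynomial.isUnit_iff.1 w.isUnit
  rw [← hc, substY, eval₂_C, algebraMap_eq_comp_C, RingHom.comp_apply]

theorem substY_mul (s : FunField) (P Q : Poly2 ℂ) : substY s (P * Q) = substY s P * substY s Q :=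
  eval₂_mul _ _

theorem substY_reverse {s : FunField} (hs : s ≠ 0) (P : Poly2 ℂ) :
    substY s⁻¹ P.reverse = substY s P / s ^ P.natDegree := by
  let _ := invertibleOfNonzero hs
  have h := eval₂_reverse_mul_pow (algebraMap ℂ[X] FunField) s P
  rw [invOf_eq_inv] at h
  rw [eq_div_iff (pow_ne_zero _ hs)]
  exact h

theorem exists_unit_eqFinite (p : Poly2 ℂ) (hp : Irreducible p) :
    ∃ w : (Poly2 ℂ)ˣ, eqFinite (curveOf p hp) = p * w := by
  have h : Associated p (Quot.out (Associates.mk p)) := by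
    rw [← Associates.mk_eq_mk_iff_associated]
    exact (Quot.out_eq (Associates.mk p)).symm
  obtain ⟨w, hw⟩ := h
  exact ⟨w, hw.symm⟩

theorem natDegree_mul_units (p : Poly2 ℂ) (w : (Poly2 ℂ)ˣ) :
    (p * w).natDegree = p.natDegree := by
  rcases eq_or_ne p 0 with rfl | hp
  · simp
  · rw [natDegree_mul hp w.ne_zero, natDegree_eq_zero_of_isUnit w.isUnit, add_zero]

open Classical in
/-- The pullback of the curve `p = 0`, in terms of `p(q, r)`. -/
theorem pullbackPrime_curveOf {p : Poly2 ℂ} (hp : Irreducible p) {A B A' B' : Poly2 ℂ}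
    {r : FunField} (hr : r ≠ 0) (hA : A ≠ 0) (hB : B ≠ 0) (hA' : A' ≠ 0) (hB' : B' ≠ 0)
    (h1 : substY r p = algebraMap (Poly2 ℂ) FunField A / algebraMap (Poly2 ℂ) FunField B)
    (h2 : substY r p / r ^ p.natDegree =
      algebraMap (Poly2 ℂ) FunField A' / algebraMap (Poly2 ℂ) FunField B') :
    pullbackPrime r (curveOf p hp) =
      (zeroDivisor A - zeroDivisor B + Finsupp.single none
        ((B.natDegree : ℤ) - A.natDegree)).filter (fun E => 0 ≤ principal r E) +
      (zeroDivisor A' - zeroDivisor B' + Finsupp.single none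
        ((B'.natDegree : ℤ) - A'.natDegree)).filter (fun E => principal r E < 0) := by
  obtain ⟨w, hw⟩ := exists_unit_eqFinite p hp
  have hinf : eqInfinite (curveOf p hp) = (eqFinite (curveOf p hp)).reverse := rfl
  have h3 : substY r (p * w) =
      algebraMap (Poly2 ℂ) FunField (A * w) / algebraMap (Poly2 ℂ) FunField B := by
    rw [substY_mul, h1, substY_unit, map_mul, div_mul_eq_mul_div]
  -- In the chart at infinity the equation pulls back to `p(q, r) / r ^ deg p`. The unit `w`, from
  -- the choice of a representative of the curve, does not affect divisors.
  have h4 : substY r⁻¹ (p * w).reverse =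
      algebraMap (Poly2 ℂ) FunField (A' * w) / algebraMap (Poly2 ℂ) FunField B' := by
    rw [substY_reverse hr, natDegree_mul_units, substY_mul, substY_unit, mul_div_right_comm, h2,
      map_mul, div_mul_eq_mul_div]
  rw [pullbackPrime, hinf, hw, h3, h4, principal_div (mul_ne_zero hA w.ne_zero) hB,
    principal_div (mul_ne_zero hA' w.ne_zero) hB', zeroDivisor_mul_unit, zeroDivisor_mul_unit,
    natDegree_mul_units, natDegree_mul_units]

/-! ### The two components of `S₀` and their pullbacks -/

theorem irreducible_qVar : Irreducible qVar :=
  (prime_C_iff.2 prime_X).irreducible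

theorem irreducible_line : Irreducible (yVar + qVar - 1) := by
  have h := (prime_X_sub_C (1 - X : ℂ[X])).irreducible
  have h' : (X - C (1 - X) : Poly2 ℂ) = yVar + qVar - 1 := by
    rw [C_sub, C_1, yVar, qVar]
    ring
  rwa [h'] at h

theorem natDegree_line : (yVar + qVar - 1 : Poly2 ℂ).natDegree = 1 := by
  have h' : yVar + qVar - 1 = (X - C (1 - X) : Poly2 ℂ) := by
    rw [C_sub, C_1, yVar, qVar]
    ring
  rw [h', natDegree_X_sub_C]

theorem substY_qVar (r : FunField) : substY r qVar = algebraMap (Poly2 ℂ) FunField qVar := by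
  rw [substY, qVar, eval₂_C, algebraMap_eq_comp_C, RingHom.comp_apply]

theorem substY_line (r : FunField) :
    substY r (yVar + qVar - 1) = r + algebraMap (Poly2 ℂ) FunField (qVar - 1) := by
  have h := substY_qVar r
  rw [substY] at h ⊢
  rw [eval₂_sub, eval₂_add, h, yVar, eval₂_X, eval₂_one, map_sub, map_one]
  ring

theorem pullbackPrime_qVar {r : FunField} (hr : r ≠ 0) :
    pullbackPrime r (curveOf qVar irreducible_qVar) = zeroDivisor qVar := by
  classical
  have hq : (qVar : Poly2 ℂ).natDegree = 0 := natDegree_C _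
  have h1 : substY r qVar =
      algebraMap (Poly2 ℂ) FunField qVar / algebraMap (Poly2 ℂ) FunField 1 := by
    rw [substY_qVar, map_one, div_one]
  have h2 : substY r qVar / r ^ (qVar : Poly2 ℂ).natDegree =
      algebraMap (Poly2 ℂ) FunField qVar / algebraMap (Poly2 ℂ) FunField 1 := by
    rw [hq, pow_zero, div_one, h1]
  rw [pullbackPrime_curveOf irreducible_qVar hr irreducible_qVar.ne_zero one_ne_zero
    irreducible_qVar.ne_zero one_ne_zero h1 h2, hq, natDegree_one, zeroDivisor_one]
  simp only [Nat.cast_zero, sub_self, sub_zero, Finsupp.single_zero, add_zero]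
  simp_rw [← not_le]
  exact Finsupp.filter_add_filter_not _ _

/-- With `W = P + (q - 1) Q`, the equation of the line pulls back to `W / Q` in the finite chart and
to `W / P` at infinity. By coprimality, the denominator has order zero along every finite curve
where its chart is used, so only `W` remains. -/
theorem pullbackPrime_line {P Q : Poly2 ℂ} (hP : P ≠ 0) (hQ : Q ≠ 0) (hPQ : IsRelPrime P Q)
    (hdeg : Q.natDegree < P.natDegree) (hW : (P + (qVar - 1) * Q).natDegree = P.natDegree) :
    pullbackPrime (algebraMap (Poly2 ℂ) FunField P / algebraMap (Poly2 ℂ) FunField Q)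
      (curveOf (yVar + qVar - 1) irreducible_line) = zeroDivisor (P + (qVar - 1) * Q) := by
  classical
  have hmap : ∀ {S : Poly2 ℂ}, S ≠ 0 → algebraMap (Poly2 ℂ) FunField S ≠ 0 := fun hS => by
    rwa [Ne, FaithfulSMul.algebraMap_eq_zero_iff]
  have hP' := hmap hP
  have hQ' := hmap hQ
  have hW0 : P + (qVar - 1) * Q ≠ 0 := by
    intro h
    rw [h, natDegree_zero] at hW
    omega
  have h1 : substY (algebraMap (Poly2 ℂ) FunField P / algebraMap (Poly2 ℂ) FunField Q)
      (yVar + qVar - 1) = algebraMap (Poly2 ℂ) FunField (P + (qVar - 1) * Q) /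
        algebraMap (Poly2 ℂ) FunField Q := by
    rw [substY_line, map_add, map_mul]
    field_simp
  have h2 : substY (algebraMap (Poly2 ℂ) FunField P / algebraMap (Poly2 ℂ) FunField Q)
      (yVar + qVar - 1) / (algebraMap (Poly2 ℂ) FunField P / algebraMap (Poly2 ℂ) FunField Q) ^
        (yVar + qVar - 1 : Poly2 ℂ).natDegree =
      algebraMap (Poly2 ℂ) FunField (P + (qVar - 1) * Q) / algebraMap (Poly2 ℂ) FunField P := by
    rw [h1, natDegree_line, pow_one, div_div_div_cancel_right₀ hQ']
  rw [pullbackPrime_curveOf irreducible_line (div_ne_zero hP' hQ') hW0 hQ hW0 hP h1 h2, hW]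
  have hρ := principal_div hP hQ
  generalize principal (algebraMap (Poly2 ℂ) FunField P / algebraMap (Poly2 ℂ) FunField Q) = ρ
    at hρ
  ext E
  have hE := DFunLike.congr_fun hρ E
  simp only [Finsupp.add_apply, Finsupp.filter_apply, Finsupp.sub_apply, sub_self,
    Finsupp.single_zero, add_zero] at hE ⊢
  have hp := zeroDivisor_nonneg P E
  have hq := zeroDivisor_nonneg Q E
  have hpq := zeroDivisor_eq_zero_of_isRelPrime hP hQ hPQ (E := E)
  cases E with
  | none =>
    -- The line `y = ∞` is a pole of `r`, so the chart at infinity applies. There `W / P` has order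
    -- zero because `W` and `P` have equal degree in `y`.
    have hlt : ((Q.natDegree : ℤ) - P.natDegree) < 0 := by omega
    simp only [zeroDivisor_none, Finsupp.single_eq_same, sub_self, zero_add] at hE ⊢
    rw [hE, if_neg (not_le.2 hlt), if_pos hlt, add_zero]
  | some p =>
    have hn : (Finsupp.single (none : PrimeDivisor) ((Q.natDegree : ℤ) - P.natDegree)) (some p) =
        0 := by simp
    rw [hn, add_zero] at hE ⊢
    by_cases h0 : zeroDivisor P (some p) = 0
    · split_ifs <;> omega
    · have := hpq h0
      split_ifs <;> omega

theorem pullback_add (r : FunField) (D D' : Divisor) :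
    pullback r (D + D') = pullback r D + pullback r D' :=
  Finsupp.sum_add_index' (fun _ => zero_smul _ _) fun _ _ _ => add_smul _ _ _

theorem pullback_single (r : FunField) (E : PrimeDivisor) :
    pullback r (Finsupp.single E 1) = pullbackPrime r E := by
  rw [pullback, Finsupp.sum_single_index (h := fun F (m : ℤ) => m • pullbackPrime r F)
    (zero_smul ℤ _), one_smul]

/-! ## The lattice -/

/-- The conditional partition functions of the lattice give the iterates of the renormalization
mapping in lowest terms. -/
theorem lattice_invariant (Γ : TwoPointGraph.{u}) (o : EdgeOrder Γ.graph)
    (h2 : TwoConnected Γ.graph) (n : ℕ) :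
    (condSame (lattice Γ o n).graph (lattice Γ o n).a (lattice Γ o n).b).Monic ∧
    condDiff (lattice Γ o n).graph (lattice Γ o n).a (lattice Γ o n).b ≠ 0 ∧
    (condDiff (lattice Γ o n).graph (lattice Γ o n).a (lattice Γ o n).b).natDegree <
      (condSame (lattice Γ o n).graph (lattice Γ o n).a (lattice Γ o n).b).natDegree ∧
    IsRelPrime (condSame (lattice Γ o n).graph (lattice Γ o n).a (lattice Γ o n).b)
      (condDiff (lattice Γ o n).graph (lattice Γ o n).a (lattice Γ o n).b) ∧
    iterY (migdalKadanoff Γ) n =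
      algebraMap (Poly2 ℂ) FunField
        (condSame (lattice Γ o n).graph (lattice Γ o n).a (lattice Γ o n).b) /
      algebraMap (Poly2 ℂ) FunField
        (condDiff (lattice Γ o n).graph (lattice Γ o n).a (lattice Γ o n).b) := by
  induction n with
  | zero =>
    simp only [lattice, condSame_singleEdge, condDiff_singleEdge]
    refine ⟨monic_X, one_ne_zero, by simp [yVar], isRelPrime_one_right, ?_⟩
    rw [map_one, div_one]
    rfl
  | succ n ih =>
    set H := lattice Γ o n with hH
    obtain ⟨hu, hv0, hdeg, huv, hiter⟩ := ih
    have hl : lattice Γ o (n + 1) = Γ.subst o H := rfl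
    rw [hl, condSame_subst o H h2.2.1 hv0, condDiff_subst o H h2.2.1 hv0]
    set U := condSame Γ.graph Γ.a Γ.b with hU
    set V := condDiff Γ.graph Γ.a Γ.b with hV
    set u := condSame H.graph H.a H.b
    set v := condDiff H.graph H.a H.b
    set d := (edges Γ.graph).card
    have hUm : U.Monic := condSame_monic h2.2.1 _ _
    have hUd : U.natDegree = d := condSame_natDegree h2.2.1 _ _
    have hVd : V.degree < (d : WithBot ℕ) := condDiff_degree_lt h2.2.1 _ _
    have hVd' : V.natDegree ≤ d := natDegree_le_of_degree_le hVd.le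
    obtain ⟨p, q, hp, hq, hbez⟩ := exists_bezout h2 Γ.a_ne_b
    obtain ⟨hm, hmd⟩ := homogenize_monic hu hdeg hUm hUd
    have hrel := homogenize_isRelPrime hu hdeg hv0 huv hUm hUd hVd' hp hq
      (condResultant_ne_zero h2 Γ.a_ne_b) hbez
    have hpos : 0 < d * u.natDegree :=
      Nat.mul_pos (Nat.pos_of_ne_zero (edges_nonempty h2 Γ.a_ne_b)) (by omega)
    -- Were it zero, coprimality would make the other homogenization a unit, contrary to its
    -- positive degree.
    have hne : homogenize V d u v ≠ 0 := by
      intro h0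
      rw [h0, isRelPrime_zero_right] at hrel
      have := natDegree_eq_zero_of_isUnit hrel
      omega
    refine ⟨hm, hne, ?_, hrel, ?_⟩
    · rw [hmd, natDegree_lt_iff_degree_lt hne]
      exact homogenize_degree_lt hdeg hVd
    · have hv' : algebraMap (Poly2 ℂ) FunField v ≠ 0 := by
        rwa [Ne, FaithfulSMul.algebraMap_eq_zero_iff]
      obtain ⟨w, hw1, hw2⟩ := exists_num_den_eq (condSame_isRelPrime h2 Γ.a_ne_b)
        (condDiff_ne_zero h2 Γ.a_ne_b)
      have hw : algebraMap (Poly2 ℂ) FunField w ≠ 0 := by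
        rw [Ne, FaithfulSMul.algebraMap_eq_zero_iff]
        exact w.ne_zero
      rw [iterY, compY, migdalKadanoff, hw1, hw2, ← migdalKadanoff, substY_mul, substY_mul,
        substY_unit, mul_div_mul_right _ _ hw, hiter, map_homogenize _ hUd.le _ hv',
        map_homogenize _ hVd' _ hv', mul_div_mul_left _ _ (pow_ne_zero _ hv'), substY, substY,
        algebraMap_eq_comp_C]

theorem pottsDivisor_zero (Γ : TwoPointGraph.{u}) (o : EdgeOrder Γ.graph) :
    pottsDivisor Γ o 0 = zeroDivisor (qVar * (yVar + qVar - 1)) := by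
  rw [pottsDivisor, partitionFunction_eq]
  simp only [lattice, condSame_singleEdge, condDiff_singleEdge]
  congr 1
  ring

theorem pottsDivisor_eq_pullback (Γ : TwoPointGraph.{u}) (o : EdgeOrder Γ.graph)
    (h2 : TwoConnected Γ.graph) (n : ℕ) :
    pottsDivisor Γ o n = pullback (iterY (migdalKadanoff Γ) n) (pottsDivisor Γ o 0) := by
  obtain ⟨hu, hv0, hdeg, huv, hiter⟩ := lattice_invariant Γ o h2 n
  rw [pottsDivisor_zero, zeroDivisor_mul irreducible_qVar.ne_zero irreducible_line.ne_zero,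
    zeroDivisor_irreducible irreducible_qVar, zeroDivisor_irreducible irreducible_line,
    pullback_add, pullback_single, pullback_single, hiter, pottsDivisor, partitionFunction_eq]
  set u := condSame (lattice Γ o n).graph (lattice Γ o n).a (lattice Γ o n).b
  set v := condDiff (lattice Γ o n).graph (lattice Γ o n).a (lattice Γ o n).b
  have hc : (qVar - 1 : Poly2 ℂ) = C (X - 1) := by rw [C_sub, C_1, qVar]
  have hW : (u + (qVar - 1) * v).natDegree = u.natDegree := by
    refine natDegree_add_eq_left_of_natDegree_lt ?_
    rw [hc]
    exact (natDegree_C_mul_le _ _).trans_lt hdeg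
  have hW0 : u + (qVar - 1) * v ≠ 0 := by
    intro h
    rw [h, natDegree_zero] at hW
    omega
  have hr : algebraMap (Poly2 ℂ) FunField u / algebraMap (Poly2 ℂ) FunField v ≠ 0 := by
    refine div_ne_zero ?_ ?_
    · rw [Ne, FaithfulSMul.algebraMap_eq_zero_iff]
      exact hu.ne_zero
    · rwa [Ne, FaithfulSMul.algebraMap_eq_zero_iff]
  rw [zeroDivisor_mul irreducible_qVar.ne_zero hW0, pullbackPrime_qVar hr,
    pullbackPrime_line hu.ne_zero hv0 huv hdeg hW]

end Potts
end

theorem mainTheorem6 (Γ : Potts.TwoPointGraph.{u}) (o : Potts.EdgeOrder Γ.graph)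
    (hsymm : Γ.IsSymmetric) (h2 : Potts.TwoConnected Γ.graph) :
    Potts.HasGenericDegree (Potts.migdalKadanoff Γ) (Nat.card Γ.graph.edgeSet) ∧
    Potts.DefinedOverRat (Potts.migdalKadanoff Γ) ∧
    Potts.pottsDivisor Γ o 0 = Potts.zeroDivisor (Potts.qVar * (Potts.yVar + Potts.qVar - 1)) ∧
    ∀ n : ℕ, Potts.pottsDivisor Γ o n =
      Potts.pullback (Potts.iterY (Potts.migdalKadanoff Γ) n) (Potts.pottsDivisor Γ o 0) :=
  ⟨Potts.hasGenericDegree_migdalKadanoff Γ h2, Potts.definedOverRat_migdalKadanoff Γ h2,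
    Potts.pottsDivisor_zero Γ o, Potts.pottsDivisor_eq_pullback Γ o h2⟩
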